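/- **Setting.** Let $\mathcal H=L^2(\mathbb R)$ be the Hilbert space of one bosonic mode, $\hat q$ multiplication by $x$, $\hat p=-i\,d/dx$, $\hat a=(\hat q+i\hat p)/\sqrt2$, and let $\mathcal D(\xi)=\exp(\xi\hat a^\dagger-\xi^*\hat a)$, $\xi\in\mathbb C$, be the displacement operators; explicitly $(\mathcal D(\xi)\psi)(x)=e^{ipx-ipq/2}\,\psi(x-q)$ for $\xi=(q+ip)/\sqrt2$. A density operator is a positive operator on $\mathcal H$ of trace $1$. For a density operator $\rho$ and $s\in[-1,1]$, the $s$-ordered characteristic function is $$\chi_s(\xi;\rho)=e^{s|\xi|^2/2}\,\mathrm{Tr}\,(\rho\,\mathcal D(\xi)),$$ and the $s$-ordered quasiprobability of $\rho$ is its Fourier transform $$\Lambda_s(\alpha;\rho)=\pi^{-1}\int e^{\alpha\xi^*-\alpha^*\xi}\,\chi_s(\xi;\rho)\,d^2\xi ,$$ in general a generalized function, acting on the Schwartz functions $f$ on $\mathbb C$ whose transform $(Ff)(\xi)=\pi^{-1}\int e^{\alpha\xi^*-\alpha^*\xi}f(\alpha)\,d^2\alpha$ has compact support, by $\int\Lambda_s(\alpha;\rho)f(\alpha)\,d^2\alpha=\int\chi_s(\xi;\rho)\,(Ff)(\xi)\,d^2\xi$.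 For $s\in[-1,1]$ and real $c\neq0$, the scaling map $\Gamma_{s,c}$ is defined by $\Lambda_s(\alpha;\Gamma_{s,c}(\rho))=c^{-2}\Lambda_s(c^{-1}\alpha;\rho)$, and its dual $\widetilde\Gamma_{s,c}$ by $\Lambda_{-s}(\alpha;\widetilde\Gamma_{s,c}(\rho))=c^{2}\Lambda_{-s}(c\,\alpha;\rho)$. The map $\Gamma_{s,c}$ is called positive if, for every density operator $\rho$, $c^{-2}\Lambda_s(c^{-1}\alpha;\rho)$ is the $s$-ordered quasiprobability of some density operator; $\widetilde\Gamma_{s,c}$ is called positive if, for every density operator $\rho$, $c^{2}\Lambda_{-s}(c\,\alpha;\rho)$ is the $(-s)$-ordered quasiprobability of some density operator. **Proposition (Duality).** Let $s\in[-1,1]$ and let $a\neq0$ be real. The scaling map $\Gamma_{s,a^{-1}}\colon \Lambda_s(\alpha)\mapsto a^2\Lambda_s(a\alpha)$ is positive if and only if the dual scaling map $\widetilde\Gamma_{s,a^{-1}}\colon\Lambda_{-s}(\alpha)\mapsto a^{-2}\Lambda_{-s}(a^{-1}\alpha)$ is positive. -/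

import Mathlib

open MeasureTheory Complex
open scoped ComplexConjugate SchwartzMap

noncomputable section

namespace QuasiProb

/-- The Hilbert space `L²(ℝ; ℂ)` of one bosonic mode (Schrödinger representation), on which
`q̂` is multiplication by `x`, `p̂ = -i d/dx`, and `â = (q̂ + i p̂)/√2`. -/
abbrev ModeSpace : Type := Lp ℂ 2 (volume : Measure ℝ)

/-! ### Displacement operators -/

/-- The phase `exp (i p x - i p q / 2)`, for `ξ = (q + i p)/√2`. -/
def displacementPhase (ξ : ℂ) (x : ℝ) : ℂ :=
  Complex.exp (((√2 * ξ.im * x - ξ.re * ξ.im : ℝ) : ℂ) * I)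

theorem norm_displacementPhase (ξ : ℂ) (x : ℝ) : ‖displacementPhase ξ x‖ = 1 :=
  Complex.norm_exp_ofReal_mul_I _

theorem continuous_displacementPhase (ξ : ℂ) : Continuous (displacementPhase ξ) := by
  unfold displacementPhase
  fun_prop

/-- Translation `x ↦ x - q` of the line, `q = √2 Re ξ`. -/
def displacementShift (ξ : ℂ) (x : ℝ) : ℝ := x - √2 * ξ.re

theorem measurePreserving_displacementShift (ξ : ℂ) :
    MeasurePreserving (displacementShift ξ) (volume : Measure ℝ) volume :=
  measurePreserving_sub_right volume _

theorem memLp_displacement (ξ : ℂ) {ψ : ℝ → ℂ} (hψ : MemLp ψ 2 (volume : Measure ℝ)) :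
    MemLp (fun x => displacementPhase ξ x * ψ (displacementShift ξ x)) 2
      (volume : Measure ℝ) := by
  have h := hψ.comp_measurePreserving (measurePreserving_displacementShift ξ)
  refine h.of_le ((continuous_displacementPhase ξ).aestronglyMeasurable.mul
    h.aestronglyMeasurable) (Filter.Eventually.of_forall fun x => ?_)
  simp [norm_displacementPhase]

/-- Almost everywhere equal functions have almost everywhere equal displacements. -/
theorem displacement_congr (ξ : ℂ) {ψ φ : ℝ → ℂ} (h : ψ =ᵐ[volume] φ) :
    (fun x => displacementPhase ξ x * ψ (displacementShift ξ x)) =ᵐ[volume]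
      fun x => displacementPhase ξ x * φ (displacementShift ξ x) := by
  filter_upwards [(measurePreserving_displacementShift ξ).quasiMeasurePreserving.ae_eq_comp h]
    with x hx
  simp only [Function.comp_apply] at hx
  rw [hx]

/-- The displacement operator `D(ξ) = exp (ξ ↠- ξ* â)`. For `ξ = (q + i p)/√2` the exponent is
`i (p q̂ - q p̂) = i p x - q d/dx`, so that
`(D(ξ) ψ)(x) = exp (i p x - i p q / 2) ψ(x - q)`. -/
def displacement (ξ : ℂ) : ModeSpace →L[ℂ] ModeSpace :=
  LinearMap.mkContinuous
    { toFun := fun ψ => (memLp_displacement ξ (Lp.memLp ψ)).toLp _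
      map_add' := fun ψ φ => by
        rw [← MemLp.toLp_add]
        refine MemLp.toLp_congr _ _ ((displacement_congr ξ (Lp.coeFn_add ψ φ)).trans ?_)
        exact Filter.Eventually.of_forall fun x => by simp [mul_add]
      map_smul' := fun c ψ => by
        rw [RingHom.id_apply, ← MemLp.toLp_const_smul]
        refine MemLp.toLp_congr _ _ ((displacement_congr ξ (Lp.coeFn_smul c ψ)).trans ?_)
        exact Filter.Eventually.of_forall fun x => by simp [mul_left_comm] }
    1 (fun ψ => by
      have h := (Lp.memLp ψ).comp_measurePreserving (measurePreserving_displacementShift ξ)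
      have e : eLpNorm (fun x => displacementPhase ξ x * ψ (displacementShift ξ x)) 2 volume
          = eLpNorm ψ 2 (volume : Measure ℝ) := by
        rw [← eLpNorm_comp_measurePreserving (Lp.aestronglyMeasurable ψ)
          (measurePreserving_displacementShift ξ)]
        exact eLpNorm_congr_norm_ae
          (Filter.Eventually.of_forall fun x => by simp [norm_displacementPhase])
      simp only [LinearMap.coe_mk, AddHom.coe_mk, one_mul, Lp.norm_toLp, e]
      exact le_of_eq (Lp.norm_def ψ).symm)

theorem displacement_ae (ξ : ℂ) (ψ : ModeSpace) :
    displacement ξ ψ =ᵐ[volume]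
      fun x => displacementPhase ξ x * ψ (displacementShift ξ x) :=
  (memLp_displacement ξ (Lp.memLp ψ)).coeFn_toLp

/-! ### Density operators and their characteristic functions -/

/-- Index set of a fixed orthonormal (Hilbert) basis of the mode space. -/
def basisIndex : Set ModeSpace := (exists_hilbertBasis ℂ ModeSpace).choose

/-- A fixed orthonormal (Hilbert) basis of the mode space; traces are computed in it. (The trace
of a trace-class operator does not depend on the basis.) -/
def basis : HilbertBasis basisIndex ℂ ModeSpace :=
  (exists_hilbertBasis ℂ ModeSpace).choose_spec.choose

/-- The trace `∑ᵢ ⟨eᵢ, T eᵢ⟩` of a trace-class operator. -/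
def trace (T : ModeSpace →L[ℂ] ModeSpace) : ℂ :=
  ∑' i, inner ℂ (basis i) (T (basis i))

/-- Density operators: positive operators with (convergent) trace equal to one. -/
structure IsDensityOperator (ρ : ModeSpace →L[ℂ] ModeSpace) : Prop where
  isPositive : ρ.IsPositive
  hasTrace_one : HasSum (fun i => inner ℂ (basis i) (ρ (basis i))) (1 : ℂ)

/-- The symmetrically ordered characteristic function `χ₀(ξ; ρ) = Tr (ρ D(ξ))`. -/
def charFun₀ (ρ : ModeSpace →L[ℂ] ModeSpace) (ξ : ℂ) : ℂ := trace (ρ ∘L displacement ξ)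

/-- The `s`-ordered characteristic function `χ_s(ξ; ρ) = exp (s |ξ|² / 2) χ₀(ξ; ρ)`. -/
def charFun (s : ℝ) (ρ : ModeSpace →L[ℂ] ModeSpace) (ξ : ℂ) : ℂ :=
  ((Real.exp (s * ‖ξ‖ ^ 2 / 2) : ℝ) : ℂ) * charFun₀ ρ ξ

/-! ### Generalized functions on the phase plane

For `s > 0` the function `χ_s(· ; ρ)` may grow like a Gaussian, and its Fourier transform `Λ_s`
exists in general only as a generalized function: its test functions are the Schwartz functions
whose Fourier transform has compact support. -/

/-- The symplectic Fourier transform `(F f)(ξ) = π⁻¹ ∫ exp (α ξ* - α* ξ) f(α) d²α`. -/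
def symplecticFourier (f : ℂ → ℂ) (ξ : ℂ) : ℂ :=
  (Real.pi : ℂ)⁻¹ * ∫ α : ℂ, Complex.exp (α * conj ξ - conj α * ξ) * f α

/-- Test functions on the phase plane: Schwartz functions whose symplectic Fourier transform has
compact support. -/
structure TestFunction where
  toSchwartz : 𝓢(ℂ, ℂ)
  hasCompactSupport : HasCompactSupport (symplecticFourier toSchwartz)

/-- A generalized function `Λ` on the phase plane, given by its values
`⟨Λ, f⟩ = ∫ Λ(α) f(α) d²α` on test functions. -/
def GenFunction : Type := TestFunction → ℂ

/-- The symplectic Fourier transform of `α ↦ f(k α)` is `k⁻² (F f)(k⁻¹ ξ)`. -/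
theorem symplecticFourier_comp_smul (k : ℝˣ) (f : ℂ → ℂ) (ξ : ℂ) :
    symplecticFourier (fun α => f ((k : ℝ) • α)) ξ =
      (((k : ℝ) ^ 2)⁻¹ : ℝ) • symplecticFourier f ((k : ℝ)⁻¹ • ξ) := by
  have hk : (k : ℝ) ≠ 0 := k.ne_zero
  have h := Measure.integral_comp_smul (volume : Measure ℂ)
    (fun α => Complex.exp (α * conj ((k : ℝ)⁻¹ • ξ) - conj α * ((k : ℝ)⁻¹ • ξ)) * f α) (k : ℝ)
  have e : ∀ α : ℂ, ((k : ℝ) • α) * conj ((k : ℝ)⁻¹ • ξ) - conj ((k : ℝ) • α) * ((k : ℝ)⁻¹ • ξ)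
      = α * conj ξ - conj α * ξ := by
    intro α
    have hk' : ((k : ℝ) : ℂ) ≠ 0 := by exact_mod_cast hk
    simp only [Complex.real_smul, map_mul, Complex.conj_ofReal, Complex.ofReal_inv, map_inv₀]
    field_simp
  simp only [e, Complex.finrank_real_complex] at h
  rw [abs_of_nonneg (by positivity)] at h
  simp only [symplecticFourier, h]
  simp only [Complex.real_smul]
  ring

theorem hasCompactSupport_symplecticFourier_comp_smul (k : ℝˣ) {f : ℂ → ℂ}
    (hf : HasCompactSupport (symplecticFourier f)) :
    HasCompactSupport (symplecticFourier fun α => f ((k : ℝ) • α)) := by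
  have h := hf.comp_smul (inv_ne_zero k.ne_zero)
  have h1 := h.comp_left (g := fun z : ℂ => (((k : ℝ) ^ 2)⁻¹ : ℝ) • z) (smul_zero _)
  have h2 : symplecticFourier (fun α => f ((k : ℝ) • α)) =
      (fun z : ℂ => (((k : ℝ) ^ 2)⁻¹ : ℝ) • z) ∘ fun ξ => symplecticFourier f ((k : ℝ)⁻¹ • ξ) :=
    funext (symplecticFourier_comp_smul k f)
  rw [h2]
  exact h1

/-- The test function `α ↦ f(k α)`, for real `k ≠ 0`. -/
def TestFunction.compSmul (k : ℝˣ) (f : TestFunction) : TestFunction where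
  toSchwartz :=
    SchwartzMap.compCLMOfContinuousLinearEquiv ℂ (ContinuousLinearEquiv.smulLeft k) f.toSchwartz
  hasCompactSupport := hasCompactSupport_symplecticFourier_comp_smul k f.hasCompactSupport

theorem TestFunction.compSmul_apply (k : ℝˣ) (f : TestFunction) (α : ℂ) :
    (f.compSmul k).toSchwartz α = f.toSchwartz ((k : ℝ) * α) :=
  congrArg f.toSchwartz (Complex.real_smul (x := (k : ℝ)) (z := α))

/-- The generalized function `α ↦ k² Λ(k α)`, for real `k ≠ 0`. By the substitution `β = k α`,
`∫ k² Λ(k α) f(α) d²α = ∫ Λ(β) f(k⁻¹ β) d²β`. -/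
def GenFunction.dilate (k : ℝˣ) (Λ : GenFunction) : GenFunction :=
  fun f => Λ (f.compSmul k⁻¹)

/-! ### Quasiprobabilities and scaling maps -/

/-- The `s`-ordered quasiprobability of `ρ`,
`Λ_s(α; ρ) = π⁻¹ ∫ exp (α ξ* - α* ξ) χ_s(ξ; ρ) d²ξ`, as a generalized function:
`∫ Λ_s(α; ρ) f(α) d²α = ∫ χ_s(ξ; ρ) (F f)(ξ) d²ξ`. -/
def quasiprobability (s : ℝ) (ρ : ModeSpace →L[ℂ] ModeSpace) : GenFunction :=
  fun f => ∫ ξ : ℂ, charFun s ρ ξ * symplecticFourier f.toSchwartz ξ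

/-- The set of all `s`-ordered quasiprobabilities `Λ_s(· ; ρ)` of density operators `ρ`. -/
def quasiprobabilities (s : ℝ) : Set GenFunction :=
  {Λ | ∃ ρ : ModeSpace →L[ℂ] ModeSpace, IsDensityOperator ρ ∧ Λ = quasiprobability s ρ}

/-- The scaling `Λ(α) ↦ a⁻² Λ(a⁻¹ α)`; on `s`-ordered quasiprobabilities it is the scaling map
`Γ_{s,a}`. -/
def scaling (a : ℝˣ) (Λ : GenFunction) : GenFunction := Λ.dilate a⁻¹

/-- The scaling `Λ(α) ↦ a² Λ(a α)`; on `(-s)`-ordered quasiprobabilities it is the dual scaling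
map of `Γ_{s,a}`. -/
def dualScaling (a : ℝˣ) (Λ : GenFunction) : GenFunction := Λ.dilate a

/-- The scaling map `Γ_{s,a}`, defined by `Λ_s(α; Γ_{s,a}(ρ)) = a⁻² Λ_s(a⁻¹ α; ρ)`, is positive:
for every density operator `ρ`, the right side is the `s`-ordered quasiprobability of a density
operator. -/
def ScalingMapPositive (s : ℝ) (a : ℝˣ) : Prop :=
  Set.MapsTo (scaling a) (quasiprobabilities s) (quasiprobabilities s)

/-- The dual scaling map of `Γ_{s,a}`, defined by sending `Λ_{-s}(α; ρ)` to `a² Λ_{-s}(a α; ρ)`,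
is positive: for every density operator `ρ`, the result is the `(-s)`-ordered quasiprobability of
a density operator. -/
def DualScalingMapPositive (s : ℝ) (a : ℝˣ) : Prop :=
  Set.MapsTo (dualScaling a) (quasiprobabilities (-s)) (quasiprobabilities (-s))

end QuasiProb

end

/-!
Both maps turn out to be positive under the same explicit condition, `s (a² - 1) = |a² - 1|`, which
is found by deciding positivity of each scaling separately (`mapsTo_dilate_iff`).

Test functions have arbitrary smooth symplectic Fourier transforms of compact support, so an
equality of quasiprobabilities is an equality of characteristic functions. Hence a scaling is
positive exactly when each `ξ ↦ exp (-s (1 - t²) |ξ|² / 2) χ₀(t ξ; ρ)` is the symmetrically ordered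
characteristic function of a density operator, with `t = a⁻¹` for the scaling map, and with `t = a`
and `-s` in place of `s` for its dual. Since `|s| ≤ 1`, the exponent `c = s (1 - t²)` satisfies
`-|1 - t²| ≤ c ≤ |1 - t²|`.

* If `c = |1 - t²|`, the map is the quantum-limited attenuator or amplifier. Its output is the
  partial trace of the state `ρ ⊗ |0⟩⟨0|`, transformed by a beam splitter or a two-mode squeezer
  (`IsDensityOperator.exists_scaled`).
* If `c < |1 - t²|` and `t² < 1`, the image of the ground state would have a negative overlap with
  the first excited state. If `c < |1 - t²|` and `t² > 1`, the image of the first excited state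
  would have a negative overlap with the ground state. Overlaps are integrals of products of
  characteristic functions by Moyal's formula (`integral_kernel_mul_inner_nonneg`), and here they
  are Gaussian integrals of the sign of `c - |1 - t²|` (`integral_one_sub_mul_gaussian`).

Traces are handled by writing a density operator as a mixture `∫ |Ψ y⟩⟨Ψ y| dν(y)` of vectors:
`Tr (ρ D(ξ)) = ∫ ⟨Ψ y, D(ξ) Ψ y⟩ dν(y)` (`hasSum_trace_of_mixture`). Every `ρ` is such a mixture,
of the vectors `√ρ eⱼ` (`IsDensityOperator.exists_mixture`), and every normalized mixture is a
density operator (`exists_isDensityOperator_of_mixture`).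
-/

noncomputable section

namespace QuasiProb

/-! ### Traces of mixtures of vectors -/

section Mixture

variable {ι H : Type*} [NormedAddCommGroup H] [InnerProductSpace ℂ H]

theorem hasSum_norm_sq_inner (b : HilbertBasis ι ℂ H) (ψ : H) :
    HasSum (fun i => ‖inner ℂ (b i) ψ‖ ^ 2) (‖ψ‖ ^ 2) := by
  have h := b.hasSum_inner_mul_inner ψ ψ
  rw [inner_self_eq_norm_sq_to_K] at h
  have e : (fun i => inner ℂ ψ (b i) * inner ℂ (b i) ψ) =
      fun i => ((‖inner ℂ (b i) ψ‖ ^ 2 : ℝ) : ℂ) := by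
    funext i
    rw [← inner_conj_symm, ← Complex.normSq_eq_conj_mul_self, Complex.normSq_eq_norm_sq]
  rw [e] at h
  refine Complex.hasSum_ofReal.1 ?_
  simpa using h

/-- A weakly measurable family of vectors of a separable Hilbert space is strongly measurable: it
is the limit of its finite expansions in a countable basis. -/
theorem stronglyMeasurable_of_inner [Countable ι] (b : HilbertBasis ι ℂ H)
    {Y : Type*} [MeasurableSpace Y] {Ψ : Y → H}
    (h : ∀ f : H, StronglyMeasurable fun y => inner ℂ f (Ψ y)) : StronglyMeasurable Ψ := by
  refine stronglyMeasurable_of_tendsto (Filter.atTop : Filter (Finset ι))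
    (f := fun s y => ∑ i ∈ s, inner ℂ (b i) (Ψ y) • b i) (fun s => ?_) ?_
  · exact Finset.stronglyMeasurable_fun_sum _ fun i _ => (h (b i)).smul_const _
  · rw [tendsto_pi_nhds]
    intro y
    have := b.hasSum_repr (Ψ y)
    simp only [b.repr_apply_apply] at this
    exact this

/-- If `⟨f, T g⟩ = ∫ ⟨f, Ψ y⟩ ⟨Ψ y, g⟩ dν(y)`, that is `T = ∫ |Ψ y⟩⟨Ψ y| dν(y)` weakly, then
`Tr (T B) = ∫ ⟨Ψ y, B Ψ y⟩ dν(y)`. -/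
theorem hasSum_trace_of_mixture [CompleteSpace H] [Countable ι] (b : HilbertBasis ι ℂ H)
    {Y : Type*} [MeasurableSpace Y] {ν : Measure Y}
    {Ψ : Y → H} (hm : StronglyMeasurable Ψ) (hi : Integrable (fun y => ‖Ψ y‖ ^ 2) ν)
    {T : H →L[ℂ] H} (hT : ∀ f g, inner ℂ f (T g) = ∫ y, inner ℂ f (Ψ y) * inner ℂ (Ψ y) g ∂ν)
    (B : H →L[ℂ] H) :
    HasSum (fun i => inner ℂ (b i) (T (B (b i)))) (∫ y, inner ℂ (Ψ y) (B (Ψ y)) ∂ν) := by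
  set C := ContinuousLinearMap.adjoint B with hC
  have hB : ∀ i y, inner ℂ (Ψ y) (B (b i)) = inner ℂ (C (Ψ y)) (b i) := fun i y => by
    rw [hC, ContinuousLinearMap.adjoint_inner_left]
  set F : ι → Y → ℂ :=
    fun i y => inner ℂ (b i) (Ψ y) * inner ℂ (Ψ y) (B (b i)) with hF
  have hFm : ∀ i, StronglyMeasurable (F i) := fun i =>
    (stronglyMeasurable_const.inner hm).mul (hm.inner stronglyMeasurable_const)
  -- by the arithmetic-geometric mean inequality the terms are dominated by `G`, which is summable
  -- by Parseval's identity
  set G : ι → Y → ℝ :=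
    fun i y => ‖inner ℂ (b i) (Ψ y)‖ ^ 2 + ‖inner ℂ (b i) (C (Ψ y))‖ ^ 2 with hG
  have hFG : ∀ i y, ‖F i y‖ ≤ G i y := fun i y => by
    simp only [hF, hG, hB, norm_mul]
    rw [← norm_inner_symm (b i) (C (Ψ y))]
    nlinarith [sq_nonneg (‖inner ℂ (b i) (Ψ y)‖ - ‖inner ℂ (b i) (C (Ψ y))‖),
      sq_nonneg ‖inner ℂ (b i) (Ψ y)‖, sq_nonneg ‖inner ℂ (b i) (C (Ψ y))‖]
  have hGs : ∀ y, HasSum (fun i => G i y) (‖Ψ y‖ ^ 2 + ‖C (Ψ y)‖ ^ 2) := fun y =>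
    (hasSum_norm_sq_inner b _).add (hasSum_norm_sq_inner b _)
  have hCi : Integrable (fun y => ‖Ψ y‖ ^ 2 + ‖C (Ψ y)‖ ^ 2) ν := by
    refine hi.add ((hi.const_mul (‖C‖ ^ 2)).mono'
      ((C.continuous.comp_stronglyMeasurable hm).norm.pow 2).aestronglyMeasurable
      (Filter.Eventually.of_forall fun y => ?_))
    rw [Real.norm_of_nonneg (by positivity), ← mul_pow]
    exact pow_le_pow_left₀ (norm_nonneg _) (C.le_opNorm _) 2
  have hbound : ∀ i, ∀ᵐ y ∂ν, ‖F i y‖ ≤ G i y := fun i => Filter.Eventually.of_forall (hFG i)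
  have h := hasSum_integral_of_dominated_convergence (μ := ν) (F := F)
    (f := fun y => inner ℂ (Ψ y) (B (Ψ y))) G (fun i => (hFm i).aestronglyMeasurable) hbound
    (Filter.Eventually.of_forall fun y => (hGs y).summable)
    (hCi.congr (Filter.Eventually.of_forall fun y => ((hGs y).tsum_eq).symm))
    (Filter.Eventually.of_forall fun y => by
      have := b.hasSum_inner_mul_inner (C (Ψ y)) (Ψ y)
      rw [hC, ContinuousLinearMap.adjoint_inner_left] at this
      simp only [hF, hB]
      simpa only [mul_comm] using this)
  simpa only [hT] using h

/-- The operator `∫ |Ψ y⟩⟨Ψ y| dν(y)`. -/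
theorem exists_isPositive_of_mixture [CompleteSpace H] {Y : Type*} [MeasurableSpace Y]
    {ν : Measure Y} {Ψ : Y → H} (hm : StronglyMeasurable Ψ)
    (hi : Integrable (fun y => ‖Ψ y‖ ^ 2) ν) :
    ∃ T : H →L[ℂ] H, T.IsPositive ∧
      ∀ f g, inner ℂ f (T g) = ∫ y, inner ℂ f (Ψ y) * inner ℂ (Ψ y) g ∂ν := by
  have hR : StronglyMeasurable fun y => InnerProductSpace.rankOne ℂ (Ψ y) (Ψ y) := by
    have hc : Continuous fun ψ : H => InnerProductSpace.rankOne ℂ ψ ψ := by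
      simp only [InnerProductSpace.rankOne_def]
      exact (ContinuousLinearMap.toSpanSingletonCLE (𝕜 := ℂ) (E := H)).continuous.clm_comp
        (innerSL ℂ).continuous
    exact hc.comp_stronglyMeasurable hm
  have hRi : Integrable (fun y => InnerProductSpace.rankOne ℂ (Ψ y) (Ψ y)) ν := by
    refine hi.mono' hR.aestronglyMeasurable (Filter.Eventually.of_forall fun y => ?_)
    simp [sq]
  have hT : ∀ f g, inner ℂ f ((∫ y, InnerProductSpace.rankOne ℂ (Ψ y) (Ψ y) ∂ν) g) =
      ∫ y, inner ℂ f (Ψ y) * inner ℂ (Ψ y) g ∂ν := by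
    intro f g
    rw [ContinuousLinearMap.integral_apply hRi,
      ← integral_inner (hRi.apply_continuousLinearMap g)]
    refine integral_congr_ae (Filter.Eventually.of_forall fun y => ?_)
    simp [inner_smul_right, mul_comm]
  refine ⟨_, (ContinuousLinearMap.isPositive_iff_complex _).2 fun f => ?_, hT⟩
  have e : inner ℂ ((∫ y, InnerProductSpace.rankOne ℂ (Ψ y) (Ψ y) ∂ν) f) f =
      ((∫ y, ‖inner ℂ (Ψ y) f‖ ^ 2 ∂ν : ℝ) : ℂ) := by
    rw [← inner_conj_symm, hT, ← integral_conj, ← integral_complex_ofReal]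
    refine integral_congr_ae (Filter.Eventually.of_forall fun y => ?_)
    simp only [map_mul, inner_conj_symm]
    rw [← inner_conj_symm (𝕜 := ℂ) f (Ψ y), Complex.mul_conj,
      Complex.normSq_eq_norm_sq]
  rw [e]
  refine ⟨by simp, ?_⟩
  rw [RCLike.re_eq_complex_re, Complex.ofReal_re]
  positivity

/-- The operator `R` is the square root of `T`. -/
theorem exists_inner_eq_inner_of_isPositive [CompleteSpace H] {T : H →L[ℂ] H}
    (hT : T.IsPositive) :
    ∃ R : H →L[ℂ] H, (∀ f g, inner ℂ (R f) g = inner ℂ f (R g)) ∧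
      ∀ f g, inner ℂ f (T g) = inner ℂ (R f) (R g) := by
  have h0 : 0 ≤ T := (ContinuousLinearMap.nonneg_iff_isPositive T).2 hT
  have hRR : CFC.sqrt T * CFC.sqrt T = T := CFC.sqrt_mul_sqrt_self T h0
  have hRs : IsSelfAdjoint (CFC.sqrt T) := (CFC.sqrt_nonneg T).isSelfAdjoint
  have hRi : ∀ f g, inner ℂ (CFC.sqrt T f) g = inner ℂ f (CFC.sqrt T g) := fun f g => by
    rw [← ContinuousLinearMap.adjoint_inner_right, hRs.adjoint_eq]
  refine ⟨CFC.sqrt T, hRi, fun f g => ?_⟩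
  rw [hRi, ← mul_apply_eq_comp, hRR]

end Mixture

/-! ### Density operators as mixtures -/

theorem separableSpace_modeSpace : TopologicalSpace.SeparableSpace ModeSpace := by
  have : Fact ((2 : ENNReal) ≠ ⊤) := ⟨by simp⟩
  infer_instance

instance countable_basisIndex : Countable basisIndex := by
  have := separableSpace_modeSpace
  -- the balls of radius `1/2` about the basis vectors are disjoint
  have hd : Pairwise (Function.onFun Disjoint fun i : basisIndex =>
      Metric.ball (basis i) (1 / 2)) := by
    intro i j hij
    apply Metric.ball_disjoint_ball
    have h0 : inner ℂ (basis i) (basis j) = 0 := basis.orthonormal.2 hij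
    have h1 : ‖basis i - basis j‖ ^ 2 = 2 := by
      rw [@norm_sub_sq ℂ, h0, basis.orthonormal.1, basis.orthonormal.1]
      norm_num
    rw [dist_eq_norm]
    nlinarith [norm_nonneg (basis i - basis j)]
  have hc := Set.PairwiseDisjoint.countable_of_isOpen (s := fun i : basisIndex =>
      Metric.ball (basis i) (1 / 2 : ℝ)) (a := Set.univ) (fun i _ j _ hij => hd hij)
      (fun i _ => Metric.isOpen_ball) (fun i _ => ⟨basis i, Metric.mem_ball_self (by norm_num)⟩)
  exact Set.countable_univ_iff.mp hc

/-- A normalized mixture `∫ |Ψ y⟩⟨Ψ y| dν(y)` of vectors is a density operator. -/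
theorem exists_isDensityOperator_of_mixture {Y : Type*} [MeasurableSpace Y] {ν : Measure Y}
    {Ψ : Y → ModeSpace} (hm : StronglyMeasurable Ψ) (hi : Integrable (fun y => ‖Ψ y‖ ^ 2) ν)
    (h1 : ∫ y, ‖Ψ y‖ ^ 2 ∂ν = 1) :
    ∃ ρ, IsDensityOperator ρ ∧
      ∀ ξ, charFun₀ ρ ξ = ∫ y, inner ℂ (Ψ y) (displacement ξ (Ψ y)) ∂ν := by
  obtain ⟨T, hTp, hT⟩ := exists_isPositive_of_mixture hm hi
  refine ⟨T, ⟨hTp, ?_⟩, fun ξ => (hasSum_trace_of_mixture basis hm hi hT (displacement ξ)).tsum_eq⟩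
  have h := hasSum_trace_of_mixture basis hm hi hT (ContinuousLinearMap.id ℂ _)
  have e : ∫ y, inner ℂ (Ψ y) (Ψ y) ∂ν = (1 : ℂ) := by
    rw [← Complex.ofReal_one, ← h1, ← integral_complex_ofReal]
    refine integral_congr_ae (Filter.Eventually.of_forall fun y => ?_)
    simp [inner_self_eq_norm_sq_to_K]
  simpa only [ContinuousLinearMap.id_apply, e] using h

/-- A unit vector is a (pure) state. -/
theorem exists_isDensityOperator_of_norm_eq_one (ψ : ModeSpace) (h : ‖ψ‖ = 1) :
    ∃ ρ, IsDensityOperator ρ ∧ ∀ ξ, charFun₀ ρ ξ = inner ℂ ψ (displacement ξ ψ) := by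
  have := exists_isDensityOperator_of_mixture (ν := Measure.dirac ()) (Ψ := fun _ : Unit => ψ)
    stronglyMeasurable_const (integrable_const _) (by simp [h])
  simpa using this

theorem hasSum_integral_count {ι : Type*} [Countable ι] [MeasurableSpace ι]
    [MeasurableSingletonClass ι] {f : ι → ℂ} (hf : Summable fun j => ‖f j‖) :
    HasSum f (∫ j, f j ∂Measure.count) := by
  rw [integral_countable (integrable_count_iff.2 hf)]
  simpa [Measure.real] using hf.of_norm.hasSum

/-- Every density operator `ρ` is the mixture `∑ⱼ |√ρ eⱼ⟩⟨√ρ eⱼ|`. -/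
theorem IsDensityOperator.exists_mixture {ρ : ModeSpace →L[ℂ] ModeSpace}
    (hρ : IsDensityOperator ρ) :
    ∃ φ : basisIndex → ModeSpace, HasSum (fun j => ‖φ j‖ ^ 2) 1 ∧
      ∀ ξ, HasSum (fun j => inner ℂ (φ j) (displacement ξ (φ j))) (charFun₀ ρ ξ) := by
  let _ : MeasurableSpace basisIndex := ⊤
  have : DiscreteMeasurableSpace basisIndex := ⟨fun _ => trivial⟩
  obtain ⟨R, hRi, hρR⟩ := exists_inner_eq_inner_of_isPositive hρ.isPositive
  have hn : HasSum (fun j => ‖R (basis j)‖ ^ 2) 1 := by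
    have h := hρ.hasTrace_one
    have e : (fun i => inner ℂ (basis i) (ρ (basis i))) =
        fun i => ((‖R (basis i)‖ ^ 2 : ℝ) : ℂ) := by
      funext i
      rw [hρR, inner_self_eq_norm_sq_to_K]; simp
    rw [e] at h
    exact Complex.hasSum_ofReal.1 (by simpa using h)
  have hi : Integrable (fun j => ‖R (basis j)‖ ^ 2) (Measure.count : Measure basisIndex) :=
    integrable_count_iff.2 hn.summable.norm
  refine ⟨fun j => R (basis j), hn, fun ξ => ?_⟩
  have hT : ∀ f g, inner ℂ f (ρ g) =
      ∫ j, inner ℂ f (R (basis j)) * inner ℂ (R (basis j)) g ∂Measure.count := by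
    intro f g
    have h2 := basis.hasSum_inner_mul_inner (R f) (R g)
    simp only [hRi] at h2 ⊢
    rw [hρR, hRi]
    exact h2.unique (hasSum_integral_count h2.summable.norm)
  have ht := (hasSum_trace_of_mixture basis (Ψ := fun j => R (basis j))
    .of_discrete hi hT (displacement ξ)).tsum_eq
  have hc : charFun₀ ρ ξ = ∑' i, inner ℂ (basis i) (ρ (displacement ξ (basis i))) := rfl
  rw [hc, ht]
  refine hasSum_integral_count (Summable.of_nonneg_of_le (fun _ => norm_nonneg _) (fun j => ?_)
    (hn.summable.mul_left ‖displacement ξ‖))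
  calc _ ≤ ‖R (basis j)‖ * ‖displacement ξ (R (basis j))‖ := norm_inner_le_norm _ _
    _ ≤ ‖R (basis j)‖ * (‖displacement ξ‖ * ‖R (basis j)‖) := by
      gcongr; exact (displacement ξ).le_opNorm _
    _ = _ := by ring

/-! ### Matrix elements of displacement operators -/

theorem inner_displacement_toLp {ψ φ : ℝ → ℂ} (hψ : MemLp ψ 2 volume) (hφ : MemLp φ 2 volume)
    (ξ : ℂ) : inner ℂ (hψ.toLp ψ) (displacement ξ (hφ.toLp φ)) =
      ∫ x, conj (ψ x) * (displacementPhase ξ x * φ (displacementShift ξ x)) := by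
  rw [L2.inner_def]
  refine integral_congr_ae ?_
  filter_upwards [hψ.coeFn_toLp, (displacement_ae ξ (hφ.toLp φ)).trans
    (displacement_congr ξ hφ.coeFn_toLp)] with x h1 h2
  rw [h1, h2, RCLike.inner_apply, mul_comm]

theorem inner_displacement (ψ φ : ModeSpace) (ξ : ℂ) :
    inner ℂ ψ (displacement ξ φ) =
      ∫ x, conj (ψ x) * (displacementPhase ξ x * φ (displacementShift ξ x)) := by
  have h := inner_displacement_toLp (Lp.memLp ψ) (Lp.memLp φ) ξ
  rwa [Lp.toLp_coeFn, Lp.toLp_coeFn] at h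

theorem continuous_uncurry_displacementPhase :
    Continuous fun z : ℂ × ℝ => displacementPhase z.1 z.2 := by
  unfold displacementPhase
  fun_prop

theorem continuous_uncurry_displacementShift :
    Continuous fun z : ℂ × ℝ => displacementShift z.1 z.2 := by
  unfold displacementShift
  fun_prop

theorem stronglyMeasurable_inner_displacement (ψ φ : ModeSpace) :
    StronglyMeasurable fun ξ => inner ℂ ψ (displacement ξ φ) := by
  simp only [inner_displacement]
  refine StronglyMeasurable.integral_prod_right
    (f := fun (ξ : ℂ) (x : ℝ) =>
      conj (ψ x) * (displacementPhase ξ x * φ (displacementShift ξ x))) ?_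
  refine (Complex.continuous_conj.comp_stronglyMeasurable
    ((Lp.stronglyMeasurable ψ).comp_measurable measurable_snd)).mul
    (continuous_uncurry_displacementPhase.stronglyMeasurable.mul
    ((Lp.stronglyMeasurable φ).comp_measurable continuous_uncurry_displacementShift.measurable))

theorem norm_inner_displacement_le (ψ φ : ModeSpace) (ξ : ℂ) :
    ‖inner ℂ ψ (displacement ξ φ)‖ ≤ ‖ψ‖ * ‖φ‖ := by
  refine (norm_inner_le_norm _ _).trans ?_
  gcongr
  have h : ‖displacement ξ‖ ≤ 1 := LinearMap.mkContinuous_norm_le _ zero_le_one _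
  simpa using (displacement ξ).le_of_opNorm_le h φ

theorem IsDensityOperator.stronglyMeasurable_charFun₀ {ρ : ModeSpace →L[ℂ] ModeSpace}
    (hρ : IsDensityOperator ρ) : StronglyMeasurable (charFun₀ ρ) := by
  obtain ⟨φ, -, hc⟩ := hρ.exists_mixture
  refine stronglyMeasurable_of_tendsto (Filter.atTop : Filter (Finset basisIndex))
    (f := fun s ξ => ∑ j ∈ s, inner ℂ (φ j) (displacement ξ (φ j))) (fun s => ?_)
    (tendsto_pi_nhds.2 hc)
  exact Finset.stronglyMeasurable_fun_sum _ fun j _ => stronglyMeasurable_inner_displacement _ _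

theorem IsDensityOperator.norm_charFun₀_le {ρ : ModeSpace →L[ℂ] ModeSpace}
    (hρ : IsDensityOperator ρ) (ξ : ℂ) : ‖charFun₀ ρ ξ‖ ≤ 1 := by
  obtain ⟨φ, h1, hc⟩ := hρ.exists_mixture
  rw [← (hc ξ).tsum_eq]
  refine tsum_of_norm_bounded h1 fun j => ?_
  rw [sq]
  exact norm_inner_displacement_le _ _ _

/-! ### Gaussian integrals -/

theorem integrable_pow_mul_gaussian {b : ℝ} (hb : 0 < b) (t : ℝ) (n : ℕ) :
    Integrable fun y : ℝ => (y : ℂ) ^ n * cexp (I * t * y - b * y ^ 2) := by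
  have h := (integrable_rpow_mul_exp_neg_mul_sq hb (s := n) (by
    have : (0 : ℝ) ≤ n := n.cast_nonneg
    linarith)).norm
  refine h.mono' (by fun_prop) (Filter.Eventually.of_forall fun y => ?_)
  rw [norm_mul, Complex.norm_exp, norm_pow, Complex.norm_real, norm_mul, Real.rpow_natCast,
    norm_pow, Real.norm_of_nonneg (Real.exp_pos _).le]
  simp [← Complex.ofReal_pow]

theorem integral_gaussian_phase {b : ℝ} (hb : 0 < b) (t : ℝ) :
    ∫ y : ℝ, cexp (I * t * y - b * y ^ 2) =
      ((√(Real.pi / b) * Real.exp (-t ^ 2 / (4 * b)) : ℝ) : ℂ) := by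
  have h := fourierIntegral_gaussian (b := b) (by simpa using hb) t
  simp only [← Complex.exp_add, neg_mul, ← sub_eq_add_neg] at h
  rw [h]
  push_cast
  rw [Real.sqrt_eq_rpow, Complex.ofReal_cpow (by positivity)]
  push_cast
  rfl

/-- The second moment of a Gaussian against a character, by integrating by parts twice. -/
theorem integral_sq_mul_gaussian_phase {b : ℝ} (hb : 0 < b) (t : ℝ) :
    ∫ y : ℝ, (y : ℂ) ^ 2 * cexp (I * t * y - b * y ^ 2) =
      (((1 / (2 * b) - t ^ 2 / (4 * b ^ 2)) *
        (√(Real.pi / b) * Real.exp (-t ^ 2 / (4 * b))) : ℝ) : ℂ) := by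
  have hb' : (b : ℂ) ≠ 0 := by exact_mod_cast hb.ne'
  have i0 : Integrable fun y : ℝ => cexp (I * t * y - b * y ^ 2) := by
    simpa using integrable_pow_mul_gaussian hb t 0
  have i1 : Integrable fun y : ℝ => (y : ℂ) * cexp (I * t * y - b * y ^ 2) := by
    simpa using integrable_pow_mul_gaussian hb t 1
  have i2 := integrable_pow_mul_gaussian hb t 2
  have d0 : ∀ y : ℝ, HasDerivAt (fun y : ℝ => cexp (I * t * y - b * y ^ 2))
      (I * t * cexp (I * t * y - b * y ^ 2) - 2 * b * (y * cexp (I * t * y - b * y ^ 2))) y := by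
    intro y
    have h1 : HasDerivAt (fun z : ℂ => cexp (I * t * z - b * z ^ 2))
        (cexp (I * t * y - b * y ^ 2) * (I * t * 1 - b * (2 * (y : ℂ) ^ 1 * 1))) (y : ℂ) := by
      simpa using (((hasDerivAt_id (y : ℂ)).const_mul (I * t)).sub
        (((hasDerivAt_id (y : ℂ)).pow 2).const_mul (b : ℂ))).cexp
    convert h1.comp_ofReal using 1
    ring
  have d1 : ∀ y : ℝ, HasDerivAt (fun y : ℝ => (y : ℂ) * cexp (I * t * y - b * y ^ 2))
      (cexp (I * t * y - b * y ^ 2) + (I * t * (y * cexp (I * t * y - b * y ^ 2))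
        - 2 * b * (y ^ 2 * cexp (I * t * y - b * y ^ 2)))) y := by
    intro y
    refine (((hasDerivAt_id y).ofReal_comp).mul (d0 y)).congr_deriv ?_
    simp only [id, Complex.ofReal_one]
    ring
  have e0 := integral_eq_zero_of_hasDerivAt_of_integrable d0
    ((i0.const_mul _).sub (i1.const_mul _)) i0
  have i12 := (i1.const_mul (I * t)).sub (i2.const_mul (2 * b))
  have e1 := (integral_add i0 i12).symm.trans
    (integral_eq_zero_of_hasDerivAt_of_integrable d1 (i0.add i12) i1)
  rw [integral_sub (i0.const_mul _) (i1.const_mul _), integral_const_mul, integral_const_mul] at e0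
  rw [integral_sub' (i1.const_mul _) (i2.const_mul _), integral_const_mul, integral_const_mul] at e1
  rw [Complex.ofReal_mul, ← integral_gaussian_phase hb t]
  set J0 := ∫ y : ℝ, cexp (I * t * y - b * y ^ 2)
  set J1 := ∫ y : ℝ, (y : ℂ) * cexp (I * t * y - b * y ^ 2)
  set J2 := ∫ y : ℝ, (y : ℂ) ^ 2 * cexp (I * t * y - b * y ^ 2)
  push_cast
  have k1 : J1 = I * t * J0 / (2 * b) := by
    field_simp
    linear_combination -e0
  have k2 : J2 = (J0 + I * t * J1) / (2 * b) := by
    field_simp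
    linear_combination -e1
  rw [k2, k1]
  field_simp
  linear_combination (4 * (t : ℂ) ^ 2 * J0) * Complex.I_sq

/-! ### The ground state and the first excited state -/

/-- The ground state wave function `π^(-1/4) exp (-x²/2)`. -/
def groundFun (x : ℝ) : ℝ := √(√Real.pi)⁻¹ * Real.exp (-x ^ 2 / 2)

/-- The wave function `√2 x π^(-1/4) exp (-x²/2)` of the first excited state. -/
def excitedFun (x : ℝ) : ℝ := √2 * x * groundFun x

theorem continuous_groundFun : Continuous groundFun := by
  unfold groundFun; fun_prop

theorem continuous_excitedFun : Continuous excitedFun := by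
  unfold excitedFun; have := continuous_groundFun; fun_prop

theorem groundFun_mul_groundFun (x y : ℝ) :
    groundFun x * groundFun y = (√Real.pi)⁻¹ * Real.exp (-(x ^ 2 + y ^ 2) / 2) := by
  have h : √(√Real.pi)⁻¹ * √(√Real.pi)⁻¹ = (√Real.pi)⁻¹ := Real.mul_self_sqrt (by positivity)
  unfold groundFun
  rw [mul_mul_mul_comm, h, ← Real.exp_add]
  ring_nf

theorem memLp_groundFun : MemLp (fun x => (groundFun x : ℂ)) 2 volume := by
  refine (memLp_two_iff_integrable_sq_norm
    (Complex.continuous_ofReal.comp continuous_groundFun).aestronglyMeasurable).2 ?_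
  refine ((integrable_exp_neg_mul_sq one_pos).const_mul (√Real.pi)⁻¹).congr
    (Filter.Eventually.of_forall fun x => ?_)
  simp only [Function.comp_apply, Complex.norm_real, Real.norm_eq_abs, sq_abs]
  rw [sq (groundFun x), groundFun_mul_groundFun]
  ring_nf

theorem memLp_excitedFun : MemLp (fun x => (excitedFun x : ℂ)) 2 volume := by
  refine (memLp_two_iff_integrable_sq_norm
    (Complex.continuous_ofReal.comp continuous_excitedFun).aestronglyMeasurable).2 ?_
  refine ((integrable_rpow_mul_exp_neg_mul_sq one_pos (s := 2) (by norm_num)).const_mul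
    (2 * (√Real.pi)⁻¹)).congr (Filter.Eventually.of_forall fun x => ?_)
  simp only [Function.comp_apply, Complex.norm_real, Real.norm_eq_abs, sq_abs, excitedFun]
  rw [mul_pow, mul_pow, Real.sq_sqrt zero_le_two, sq (groundFun x), groundFun_mul_groundFun]
  simp only [Real.rpow_two]
  ring_nf

theorem displacementPhase_mul_groundFun_mul_groundFun (ξ : ℂ) (x : ℝ) :
    displacementPhase ξ (x + √2 * ξ.re / 2) *
        ((groundFun (x + √2 * ξ.re / 2) *
          groundFun (displacementShift ξ (x + √2 * ξ.re / 2)) : ℝ) : ℂ) =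
      (((√Real.pi)⁻¹ * Real.exp (-ξ.re ^ 2 / 2) : ℝ) : ℂ) *
        cexp (I * ((√2 * ξ.im : ℝ) : ℂ) * x - ((1 : ℝ) : ℂ) * x ^ 2) := by
  have h2 : ((√2 : ℝ) : ℂ) ^ 2 = 2 := by exact_mod_cast Real.sq_sqrt zero_le_two
  rw [groundFun_mul_groundFun, displacementPhase, displacementShift]
  push_cast
  rw [mul_left_comm, ← Complex.exp_add, mul_assoc (((√Real.pi : ℝ) : ℂ)⁻¹), ← Complex.exp_add]
  congr 2
  linear_combination (I * ξ.im * ξ.re / 2 - ξ.re ^ 2 / 4) * h2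

theorem integral_ground_displacement (ξ : ℂ) :
    ∫ x, conj (groundFun x : ℂ) * (displacementPhase ξ x * (groundFun (displacementShift ξ x) : ℂ))
      = ((Real.exp (-‖ξ‖ ^ 2 / 2) : ℝ) : ℂ) := by
  -- centre the integrand at half the displacement
  rw [← integral_add_right_eq_self _ (√2 * ξ.re / 2)]
  have h2 : √2 ^ 2 = 2 := Real.sq_sqrt zero_le_two
  have e : ∀ x : ℝ, conj (groundFun (x + √2 * ξ.re / 2) : ℂ) *
      (displacementPhase ξ (x + √2 * ξ.re / 2) *
        (groundFun (displacementShift ξ (x + √2 * ξ.re / 2)) : ℂ)) =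
      (((√Real.pi)⁻¹ * Real.exp (-ξ.re ^ 2 / 2) : ℝ) : ℂ) *
        cexp (I * ((√2 * ξ.im : ℝ) : ℂ) * x - ((1 : ℝ) : ℂ) * x ^ 2) := by
    intro x
    rw [Complex.conj_ofReal, mul_left_comm, ← Complex.ofReal_mul,
      displacementPhase_mul_groundFun_mul_groundFun]
  simp only [e]
  rw [integral_const_mul, integral_gaussian_phase one_pos, ← Complex.ofReal_mul]
  congr 1
  have hp : √Real.pi ≠ 0 := by positivity
  rw [div_one, mul_mul_mul_comm, inv_mul_cancel₀ hp, one_mul, ← Real.exp_add, 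
    ← Complex.normSq_eq_norm_sq, Complex.normSq_apply, mul_pow, h2]
  ring_nf

theorem integral_excited_displacement (ξ : ℂ) :
    ∫ x, conj (excitedFun x : ℂ) *
      (displacementPhase ξ x * (excitedFun (displacementShift ξ x) : ℂ))
      = (((1 - ‖ξ‖ ^ 2) * Real.exp (-‖ξ‖ ^ 2 / 2) : ℝ) : ℂ) := by
  rw [← integral_add_right_eq_self _ (√2 * ξ.re / 2)]
  have h2 : √2 ^ 2 = 2 := Real.sq_sqrt zero_le_two
  have e : ∀ x : ℝ, conj (excitedFun (x + √2 * ξ.re / 2) : ℂ) *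
      (displacementPhase ξ (x + √2 * ξ.re / 2) *
        (excitedFun (displacementShift ξ (x + √2 * ξ.re / 2)) : ℂ)) =
      (((√Real.pi)⁻¹ * Real.exp (-ξ.re ^ 2 / 2) : ℝ) : ℂ) *
        (2 * (x ^ 2 * cexp (I * ((√2 * ξ.im : ℝ) : ℂ) * x - ((1 : ℝ) : ℂ) * x ^ 2)) -
          ξ.re ^ 2 * cexp (I * ((√2 * ξ.im : ℝ) : ℂ) * x - ((1 : ℝ) : ℂ) * x ^ 2)) := by
    intro x
    have e1 : excitedFun (x + √2 * ξ.re / 2) * excitedFun (displacementShift ξ (x + √2 * ξ.re / 2))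
        = (2 * x ^ 2 - ξ.re ^ 2) * (groundFun (x + √2 * ξ.re / 2) *
          groundFun (displacementShift ξ (x + √2 * ξ.re / 2))) := by
      simp only [excitedFun, displacementShift]
      linear_combination (groundFun (x + √2 * ξ.re / 2) *
        groundFun (x + √2 * ξ.re / 2 - √2 * ξ.re)) *
          (x ^ 2 - (√2 ^ 2 + 2) * ξ.re ^ 2 / 4) * h2
    rw [Complex.conj_ofReal, mul_left_comm, ← Complex.ofReal_mul, e1, Complex.ofReal_mul,
      mul_left_comm, displacementPhase_mul_groundFun_mul_groundFun]
    push_cast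
    ring
  have i0 := integrable_pow_mul_gaussian one_pos (√2 * ξ.im) 0
  simp only [pow_zero, one_mul] at i0
  have i2 := integrable_pow_mul_gaussian one_pos (√2 * ξ.im) 2
  simp only [e]
  rw [integral_const_mul, integral_sub (i2.const_mul _) (i0.const_mul _), integral_const_mul,
    integral_const_mul, integral_gaussian_phase one_pos, integral_sq_mul_gaussian_phase one_pos]
  have hn : ‖ξ‖ ^ 2 = ξ.re ^ 2 + ξ.im ^ 2 := by
    rw [← Complex.normSq_eq_norm_sq, Complex.normSq_apply]; ring
  have hp : (√Real.pi)⁻¹ * √Real.pi = 1 := inv_mul_cancel₀ (by positivity)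
  rw [hn]
  have he : Real.exp (-(ξ.re ^ 2 + ξ.im ^ 2) / 2) =
      Real.exp (-ξ.re ^ 2 / 2) * Real.exp (-(√2 * ξ.im) ^ 2 / (4 * 1)) := by
    rw [← Real.exp_add, mul_pow, h2]; ring_nf
  rw [he, div_one, mul_pow, h2]
  push_cast
  have hp' : ((√Real.pi : ℝ) : ℂ)⁻¹ * ((√Real.pi : ℝ) : ℂ) = 1 := by exact_mod_cast hp
  linear_combination ((1 - (ξ.re ^ 2 + ξ.im ^ 2)) * cexp (-ξ.re ^ 2 / 2) *
    cexp (-(2 * ξ.im ^ 2) / (4 * 1))) * hp'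

/-- The ground state. -/
def groundState : ModeSpace := memLp_groundFun.toLp _

/-- The first excited state. -/
def excitedState : ModeSpace := memLp_excitedFun.toLp _

theorem inner_groundState_displacement (ξ : ℂ) :
    inner ℂ groundState (displacement ξ groundState) = ((Real.exp (-‖ξ‖ ^ 2 / 2) : ℝ) : ℂ) :=
  (inner_displacement_toLp _ _ ξ).trans (integral_ground_displacement ξ)

theorem inner_excitedState_displacement (ξ : ℂ) :
    inner ℂ excitedState (displacement ξ excitedState) =
      (((1 - ‖ξ‖ ^ 2) * Real.exp (-‖ξ‖ ^ 2 / 2) : ℝ) : ℂ) :=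
  (inner_displacement_toLp _ _ ξ).trans (integral_excited_displacement ξ)

theorem displacement_zero (ψ : ModeSpace) : displacement 0 ψ = ψ := by
  refine Lp.ext ((displacement_ae 0 ψ).trans (Filter.Eventually.of_forall fun x => ?_))
  simp [displacementPhase, displacementShift]

theorem norm_eq_one_of_inner_displacement {ψ : ModeSpace}
    (h : inner ℂ ψ (displacement 0 ψ) = 1) : ‖ψ‖ = 1 := by
  rw [displacement_zero, inner_self_eq_norm_sq_to_K] at h
  have h' : ‖ψ‖ ^ 2 = 1 := Complex.ofReal_injective ((Complex.ofReal_pow _ _).trans h)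
  exact (pow_eq_one_iff_of_nonneg (norm_nonneg _) two_ne_zero).1 h'

/-- The ground state has characteristic function `exp (-|ξ|²/2)`. -/
theorem exists_isDensityOperator_ground : ∃ ρ, IsDensityOperator ρ ∧
    ∀ ξ, charFun₀ ρ ξ = ((Real.exp (-‖ξ‖ ^ 2 / 2) : ℝ) : ℂ) := by
  obtain ⟨ρ, hρ, h⟩ := exists_isDensityOperator_of_norm_eq_one groundState
    (norm_eq_one_of_inner_displacement (by simp [inner_groundState_displacement]))
  exact ⟨ρ, hρ, fun ξ => (h ξ).trans (inner_groundState_displacement ξ)⟩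

/-- The first excited state has characteristic function `(1 - |ξ|²) exp (-|ξ|²/2)`. -/
theorem exists_isDensityOperator_excited : ∃ ρ, IsDensityOperator ρ ∧
    ∀ ξ, charFun₀ ρ ξ = (((1 - ‖ξ‖ ^ 2) * Real.exp (-‖ξ‖ ^ 2 / 2) : ℝ) : ℂ) := by
  obtain ⟨ρ, hρ, h⟩ := exists_isDensityOperator_of_norm_eq_one excitedState
    (norm_eq_one_of_inner_displacement (by simp [inner_excitedState_displacement]))
  exact ⟨ρ, hρ, fun ξ => (h ξ).trans (inner_excitedState_displacement ξ)⟩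

/-! ### Attenuators and amplifiers -/

theorem measurePreserving_of_det_eq_one {α β γ δ : ℝ} (h : α * δ - β * γ = 1) :
    MeasurePreserving (fun z : ℝ × ℝ => (α * z.1 + β * z.2, γ * z.1 + δ * z.2))
      (volume : Measure (ℝ × ℝ)) volume := by
  set f : ℝ × ℝ →ₗ[ℝ] ℝ × ℝ :=
    Matrix.toLin (Module.Basis.finTwoProd ℝ) (Module.Basis.finTwoProd ℝ) !![α, β; γ, δ] with hf
  have hdet : LinearMap.det f = 1 := by
    rw [hf, LinearMap.det_toLin, Matrix.det_fin_two_of, h]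
  have hfun : (fun z : ℝ × ℝ => (α * z.1 + β * z.2, γ * z.1 + δ * z.2)) = f := by
    funext z
    rw [hf, Matrix.toLin_finTwoProd_apply]
  refine ⟨by fun_prop, ?_⟩
  rw [hfun, Measure.map_linearMap_addHaar_eq_smul_addHaar _ (by rw [hdet]; exact one_ne_zero), hdet]
  simp

theorem integrable_conj_mul_displacement {ψ φ : ℝ → ℂ} (hψ : MemLp ψ 2 volume)
    (hφ : MemLp φ 2 volume) (ξ : ℂ) :
    Integrable fun x => conj (ψ x) * (displacementPhase ξ x * φ (displacementShift ξ x)) :=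
  MemLp.integrable_mul (p := 2) (q := 2) hψ.star (memLp_displacement ξ hφ)

/-- The two-mode wave function `φ ⊗ ground` after the linear change of variables
`(x, y) ↦ (t x + β y, γ x + t y)`, as a function of `x`. -/
def twoModeFun (t β γ : ℝ) (φ : ModeSpace) (y x : ℝ) : ℂ :=
  φ (t * x + β * y) * groundFun (γ * x + t * y)

theorem stronglyMeasurable_uncurry_twoModeFun (t β γ : ℝ) (φ : ModeSpace) :
    StronglyMeasurable (Function.uncurry (twoModeFun t β γ φ)) := by
  refine ((Lp.stronglyMeasurable φ).comp_measurable (g := fun z : ℝ × ℝ => t * z.2 + β * z.1)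
    (by fun_prop)).mul (Continuous.stronglyMeasurable ?_)
  have := continuous_groundFun
  fun_prop

theorem memLp_twoModeFun {t : ℝ} (ht : t ≠ 0) (β γ : ℝ) (φ : ModeSpace) (y : ℝ) :
    MemLp (twoModeFun t β γ φ y) 2 volume := by
  have hsm : StronglyMeasurable (twoModeFun t β γ φ y) :=
    (stronglyMeasurable_uncurry_twoModeFun t β γ φ).comp_measurable measurable_prodMk_left
  have h1 : StronglyMeasurable fun x => φ (t * x + β * y) :=
    (Lp.stronglyMeasurable φ).comp_measurable (by fun_prop)
  have h2 : MemLp (fun x => φ (t * x + β * y)) 2 volume := by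
    refine (memLp_two_iff_integrable_sq_norm h1.aestronglyMeasurable).2 ?_
    exact ((((memLp_two_iff_integrable_sq_norm (Lp.memLp φ).1).1 (Lp.memLp φ)).comp_add_right
      (β * y)).comp_mul_left' ht)
  refine (h2.const_mul ((√(√Real.pi)⁻¹ : ℝ) : ℂ)).mono hsm.aestronglyMeasurable
    (Filter.Eventually.of_forall fun x => ?_)
  rw [twoModeFun, mul_comm, norm_mul, norm_mul]
  gcongr
  rw [Complex.norm_real, Complex.norm_real, groundFun, norm_mul]
  refine mul_le_of_le_one_right (norm_nonneg _) ?_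
  rw [Real.norm_of_nonneg (Real.exp_pos _).le, Real.exp_le_one_iff]
  have := sq_nonneg (γ * x + t * y)
  linarith

/-- The two-mode wave function factorizes in the rotated variables, and the displacement of the
first mode becomes a product of displacements. -/
theorem conj_twoModeFun_mul_displacement {t β γ : ℝ} (h : t * t - γ * β = 1) (φ : ModeSpace)
    (ξ : ℂ) (y x : ℝ) :
    conj (twoModeFun t β γ φ y x) *
        (displacementPhase ξ x * twoModeFun t β γ φ y (displacementShift ξ x)) =
      (fun w => conj (groundFun w : ℂ) * (displacementPhase ⟨γ * ξ.re, -(β * ξ.im)⟩ w *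
        (groundFun (displacementShift ⟨γ * ξ.re, -(β * ξ.im)⟩ w) : ℂ))) (t * y + γ * x) *
      (fun u => conj (φ u) * (displacementPhase (t * ξ) u * φ (displacementShift (t * ξ) u)))
        (β * y + t * x) := by
  have hp : displacementPhase ξ x = displacementPhase ⟨γ * ξ.re, -(β * ξ.im)⟩ (t * y + γ * x) *
      displacementPhase (t * ξ) (β * y + t * x) := by
    simp only [displacementPhase, ← Complex.exp_add]
    rw [← add_mul, ← Complex.ofReal_add]
    congr 3
    simp only [Complex.re_ofReal_mul, Complex.im_ofReal_mul]
    linear_combination (-(√2 * ξ.im * x) + ξ.re * ξ.im) * h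
  have e1 : t * displacementShift ξ x + β * y = displacementShift (t * ξ) (β * y + t * x) := by
    simp only [displacementShift, Complex.re_ofReal_mul]; ring
  have e2 : γ * displacementShift ξ x + t * y =
      displacementShift ⟨γ * ξ.re, -(β * ξ.im)⟩ (t * y + γ * x) := by
    simp only [displacementShift]; ring
  simp only [twoModeFun, e1, e2, hp, map_mul]
  rw [add_comm (t * x), add_comm (γ * x)]
  ring

/-- The slices `Ψ_y` of the two-mode wave function as vectors of the mode space. -/
def twoModeSlice {t : ℝ} (ht : t ≠ 0) (β γ : ℝ) (φ : ModeSpace) (y : ℝ) : ModeSpace :=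
  (memLp_twoModeFun ht β γ φ y).toLp _

theorem stronglyMeasurable_inner_twoModeSlice {t : ℝ} (ht : t ≠ 0) (β γ : ℝ) (φ f : ModeSpace) :
    StronglyMeasurable fun y => inner ℂ f (twoModeSlice ht β γ φ y) := by
  have e : (fun y => inner ℂ f (twoModeSlice ht β γ φ y)) =
      fun y => ∫ x, twoModeFun t β γ φ y x * conj (f x) := by
    funext y
    rw [L2.inner_def]
    refine integral_congr_ae ?_
    filter_upwards [(memLp_twoModeFun ht β γ φ y).coeFn_toLp] with x hx
    rw [twoModeSlice, hx, RCLike.inner_apply]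
  rw [e]
  refine StronglyMeasurable.integral_prod_right
    (f := fun (y : ℝ) (x : ℝ) => twoModeFun t β γ φ y x * conj (f x)) ?_
  exact (stronglyMeasurable_uncurry_twoModeFun t β γ φ).mul
    (Complex.continuous_conj.comp_stronglyMeasurable
      ((Lp.stronglyMeasurable f).comp_measurable measurable_snd))

/-- The partial trace over the second mode multiplies the characteristic function of `φ`, with
rescaled argument, by that of the ground state. -/
theorem integral_inner_twoModeSlice {t β γ : ℝ} (ht : t ≠ 0) (h : t * t - γ * β = 1)
    (φ : ModeSpace) (ξ : ℂ) :
    Integrable (fun y => inner ℂ (twoModeSlice ht β γ φ y)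
      (displacement ξ (twoModeSlice ht β γ φ y))) ∧
    ∫ y, inner ℂ (twoModeSlice ht β γ φ y) (displacement ξ (twoModeSlice ht β γ φ y)) =
      ((Real.exp (-(γ ^ 2 * ξ.re ^ 2 + β ^ 2 * ξ.im ^ 2) / 2) : ℝ) : ℂ) *
        inner ℂ φ (displacement (t * ξ) φ) := by
  have hA := integrable_conj_mul_displacement (Lp.memLp φ) (Lp.memLp φ) (t * ξ)
  have hB := integrable_conj_mul_displacement memLp_groundFun memLp_groundFun
    ⟨γ * ξ.re, -(β * ξ.im)⟩
  have hM := measurePreserving_of_det_eq_one h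
  have hBA := hB.mul_prod hA
  have hI := hM.integrable_comp_of_integrable hBA
  have hcongr : ∀ y x : ℝ, _ := conj_twoModeFun_mul_displacement h φ ξ
  have hin : ∀ y, inner ℂ (twoModeSlice ht β γ φ y) (displacement ξ (twoModeSlice ht β γ φ y)) =
      ∫ x, conj (twoModeFun t β γ φ y x) *
        (displacementPhase ξ x * twoModeFun t β γ φ y (displacementShift ξ x)) := fun y =>
    inner_displacement_toLp _ _ ξ
  simp only [hin, hcongr]
  refine ⟨hI.integral_prod_left, ?_⟩
  have h3 := integral_prod _ hI
  refine h3.symm.trans ?_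
  have h4 := integral_map hM.aemeasurable (f := fun z : ℝ × ℝ =>
    conj (groundFun z.1 : ℂ) * (displacementPhase ⟨γ * ξ.re, -(β * ξ.im)⟩ z.1 *
      (groundFun (displacementShift ⟨γ * ξ.re, -(β * ξ.im)⟩ z.1) : ℂ)) *
    (conj (φ z.2) * (displacementPhase (t * ξ) z.2 * φ (displacementShift (t * ξ) z.2))))
    (by rw [hM.map_eq]; exact hBA.1)
  rw [hM.map_eq] at h4
  refine h4.symm.trans ?_
  refine (integral_prod_mul (μ := volume) (ν := volume) (fun w : ℝ => conj (groundFun w : ℂ) *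
    (displacementPhase ⟨γ * ξ.re, -(β * ξ.im)⟩ w *
      (groundFun (displacementShift ⟨γ * ξ.re, -(β * ξ.im)⟩ w) : ℂ)))
    (fun u : ℝ => conj (φ u) *
      (displacementPhase (t * ξ) u * φ (displacementShift (t * ξ) u)))).trans ?_
  rw [integral_ground_displacement, inner_displacement φ φ, ← Complex.normSq_eq_norm_sq,
    Complex.normSq_apply]
  congr 5
  ring

theorem integral_norm_sq_twoModeSlice {t β γ : ℝ} (ht : t ≠ 0) (h : t * t - γ * β = 1)
    (φ : ModeSpace) :
    Integrable (fun y => ‖twoModeSlice ht β γ φ y‖ ^ 2) ∧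
    ∫ y, ‖twoModeSlice ht β γ φ y‖ ^ 2 = ‖φ‖ ^ 2 := by
  obtain ⟨h1, h2⟩ := integral_inner_twoModeSlice ht h φ 0
  have e : ∀ ψ : ModeSpace, inner ℂ ψ ψ = ((‖ψ‖ ^ 2 : ℝ) : ℂ) := fun ψ => by
    rw [inner_self_eq_norm_sq_to_K]; simp
  simp only [mul_zero, displacement_zero, e] at h1 h2
  refine ⟨h1.re, ?_⟩
  rw [integral_complex_ofReal] at h2
  exact Complex.ofReal_injective (h2.trans (by simp))

/-- The quantum-limited attenuator (`|t| < 1`) and amplifier (`|t| > 1`): rescaling the argument of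
a characteristic function by `t` is compensated by the Gaussian factor `exp (-|t² - 1| |ξ|² / 2)`.
The output state is the partial trace over an auxiliary mode, initially in its ground state, after
a beam splitter or a two-mode squeezer. -/
theorem IsDensityOperator.exists_scaled {ρ : ModeSpace →L[ℂ] ModeSpace}
    (hρ : IsDensityOperator ρ) {t : ℝ} (ht : t ≠ 0) :
    ∃ σ, IsDensityOperator σ ∧ ∀ ξ, charFun₀ σ ξ =
      ((Real.exp (-(|t ^ 2 - 1| * ‖ξ‖ ^ 2) / 2) : ℝ) : ℂ) * charFun₀ ρ (t * ξ) := by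
  -- `β = ±γ`, with `+` for the two-mode squeezer and `-` for the beam splitter
  obtain ⟨β, γ, h, hβ, hγ⟩ : ∃ β γ : ℝ, t * t - γ * β = 1 ∧ β ^ 2 = |t ^ 2 - 1| ∧
      γ ^ 2 = |t ^ 2 - 1| := by
    have hs : √|t ^ 2 - 1| ^ 2 = |t ^ 2 - 1| := Real.sq_sqrt (abs_nonneg _)
    rcases le_total 0 (t ^ 2 - 1) with h0 | h0
    · refine ⟨√|t ^ 2 - 1|, √|t ^ 2 - 1|, ?_, hs, hs⟩
      rw [abs_of_nonneg h0] at hs ⊢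
      linear_combination -hs
    · refine ⟨-√|t ^ 2 - 1|, √|t ^ 2 - 1|, ?_, by rw [neg_sq, hs], hs⟩
      rw [abs_of_nonpos h0] at hs ⊢
      linear_combination hs
  obtain ⟨φ, hφ1, hφ⟩ := hρ.exists_mixture
  let _ : MeasurableSpace basisIndex := ⊤
  have : DiscreteMeasurableSpace basisIndex := ⟨fun _ => trivial⟩
  set ν : Measure (basisIndex × ℝ) := Measure.count.prod volume
  set Ψ : basisIndex × ℝ → ModeSpace := fun z => twoModeSlice ht β γ (φ z.1) z.2 with hΨ
  have hm : StronglyMeasurable Ψ := stronglyMeasurable_of_inner basis fun f =>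
    (measurable_from_prod_countable_right fun j =>
      (stronglyMeasurable_inner_twoModeSlice ht β γ (φ j) f).measurable).stronglyMeasurable
  have hn := fun j => integral_norm_sq_twoModeSlice ht h (φ j)
  have hi : Integrable (fun z => ‖Ψ z‖ ^ 2) ν := by
    refine (integrable_prod_iff (hm.norm.pow 2).aestronglyMeasurable).2
      ⟨Filter.Eventually.of_forall fun j => (hn j).1, ?_⟩
    simp only [hΨ, Pi.pow_apply, norm_pow, norm_norm, (hn _).2]
    exact integrable_count_iff.2 hφ1.summable.norm
  have h1 : ∫ z, ‖Ψ z‖ ^ 2 ∂ν = 1 := by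
    rw [integral_prod _ hi]
    simp only [hΨ, (hn _).2]
    rw [integral_countable (integrable_count_iff.2 hφ1.summable.norm)]
    simpa [Measure.real] using hφ1.tsum_eq
  obtain ⟨σ, hσ, hc⟩ := exists_isDensityOperator_of_mixture hm hi h1
  refine ⟨σ, hσ, fun ξ => ?_⟩
  have hI : Integrable (fun z => inner ℂ (Ψ z) (displacement ξ (Ψ z))) ν := by
    refine hi.mono' (hm.inner ((displacement ξ).continuous.comp_stronglyMeasurable
      hm)).aestronglyMeasurable (Filter.Eventually.of_forall fun z => ?_)
    rw [sq]
    exact norm_inner_displacement_le _ _ _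
  have hnorm : ‖ξ‖ ^ 2 = ξ.re ^ 2 + ξ.im ^ 2 := by
    rw [← Complex.normSq_eq_norm_sq, Complex.normSq_apply]; ring
  rw [hc, integral_prod _ hI]
  simp only [hΨ, (integral_inner_twoModeSlice ht h _ ξ).2]
  rw [integral_const_mul, hβ, hγ, ← mul_add, ← hnorm]
  congr 1
  exact (hasSum_integral_count (hφ (t * ξ)).summable.norm).unique (hφ (t * ξ))

/-! ### Overlaps with the ground state and the first excited state -/

/-- Moyal's formula in the form of an inequality: if the partial Fourier transform of `K` makes
`∫ K(ξ) D(ξ) d²ξ` a nonnegative multiple of the projection onto `g`, then the characteristic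
function of any vector has a nonnegative pairing with `K`. -/
theorem integral_kernel_mul_inner_nonneg {K : ℂ → ℂ} (hK : Integrable K)
    {g : ℝ → ℝ} (hgc : Continuous g) (hg : MemLp (fun x => (g x : ℂ)) 2 volume) {C : ℝ} (hC : 0 ≤ C)
    (h : ∀ r x : ℝ, ∫ η : ℝ, K ⟨r, η⟩ * displacementPhase ⟨r, η⟩ x =
      ((C * (g x * g (x - √2 * r)) : ℝ) : ℂ)) (ψ : ModeSpace) :
    0 ≤ (∫ ξ, K ξ * inner ℂ ψ (displacement ξ ψ)).re := by
  have hI : Integrable fun ξ => K ξ * inner ℂ ψ (displacement ξ ψ) :=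
    hK.mul_bdd (c := ‖ψ‖ * ‖ψ‖) (stronglyMeasurable_inner_displacement ψ ψ).aestronglyMeasurable
      (Filter.Eventually.of_forall fun ξ => norm_inner_displacement_le ψ ψ ξ)
  have hmp := Complex.volume_preserving_equiv_real_prod.symm
  have hI2 := hmp.integrable_comp_of_integrable hI
  have e1 : ∫ ξ, K ξ * inner ℂ ψ (displacement ξ ψ) =
      ∫ r : ℝ, ∫ η : ℝ, K ⟨r, η⟩ * inner ℂ ψ (displacement ⟨r, η⟩ ψ) := by
    rw [← hmp.integral_comp (MeasurableEquiv.measurableEmbedding _)]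
    exact integral_prod _ hI2
  set F : ℝ → ℂ := fun x => ψ x * g x with hF
  have hFi : Integrable F := MemLp.integrable_mul (p := 2) (q := 2) (Lp.memLp ψ) hg
  have hFm : StronglyMeasurable F := (Lp.stronglyMeasurable ψ).mul
    (Complex.continuous_ofReal.comp hgc).stronglyMeasurable
  have h2 : (√2 : ℝ) ≠ 0 := by positivity
  have e2 : ∀ᵐ r : ℝ, ∫ η : ℝ, K ⟨r, η⟩ * inner ℂ ψ (displacement ⟨r, η⟩ ψ) =
      C * ∫ x : ℝ, conj (F x) * F (x - √2 * r) := by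
    filter_upwards [(hmp.integrable_comp_of_integrable hK).prod_right_ae] with r hKr
    replace hKr : Integrable fun η : ℝ => K ⟨r, η⟩ := hKr
    have hψψ : Integrable fun x => conj (ψ x) * ψ (x - √2 * r) := by
      have := (memLp_displacement ⟨r, 0⟩ (Lp.memLp ψ))
      simp only [displacementPhase, displacementShift, mul_zero, zero_mul, sub_zero,
        Complex.ofReal_zero, Complex.exp_zero, one_mul] at this
      exact MemLp.integrable_mul (p := 2) (q := 2) (Lp.memLp ψ).star this
    have hph : Continuous fun z : ℝ × ℝ => displacementPhase ⟨r, z.1⟩ z.2 := by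
      unfold displacementPhase
      fun_prop
    have hint : Integrable (Function.uncurry fun η x : ℝ =>
        K ⟨r, η⟩ * (conj (ψ x) * (displacementPhase ⟨r, η⟩ x * ψ (x - √2 * r))))
        (volume.prod volume) := by
      refine ((hKr.mul_prod hψψ).mul_bdd (c := 1) hph.aestronglyMeasurable
        (Filter.Eventually.of_forall fun z => (norm_displacementPhase _ _).le)).congr
        (Filter.Eventually.of_forall fun z => ?_)
      simp only [Function.uncurry]
      ring
    simp only [inner_displacement, displacementShift, ← integral_const_mul]
    rw [integral_integral_swap hint]
    refine integral_congr_ae (Filter.Eventually.of_forall fun x => ?_)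
    have e3 : ∀ η : ℝ, K ⟨r, η⟩ * (conj (ψ x) * (displacementPhase ⟨r, η⟩ x * ψ (x - √2 * r))) =
        (K ⟨r, η⟩ * displacementPhase ⟨r, η⟩ x) * (conj (ψ x) * ψ (x - √2 * r)) := fun η => by ring
    simp only [e3]
    rw [integral_mul_const, h]
    simp only [hF, map_mul, Complex.conj_ofReal]
    push_cast
    ring
  have hFs : ∀ x, Integrable fun r : ℝ => F (x - √2 * r) := fun x =>
    (hFi.comp_sub_left x).comp_mul_left' h2
  have hFn : ∀ {E : Type} [NormedAddCommGroup E] [NormedSpace ℝ E] (G : ℝ → E) (x : ℝ),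
      ∫ r : ℝ, G (x - √2 * r) = (√2)⁻¹ • ∫ u, G u := by
    intro E _ _ G x
    rw [Measure.integral_comp_mul_left (fun u => G (x - u)), integral_sub_left_eq_self,
      abs_of_nonneg (by positivity)]
  have hswap : Integrable (Function.uncurry fun r x : ℝ => conj (F x) * F (x - √2 * r))
      (volume.prod volume) := by
    have hm : StronglyMeasurable (Function.uncurry fun r x : ℝ => conj (F x) * F (x - √2 * r)) :=
      (Complex.continuous_conj.comp_stronglyMeasurable (hFm.comp_measurable measurable_snd)).mul
        (hFm.comp_measurable (g := fun z : ℝ × ℝ => z.2 - √2 * z.1) (by fun_prop))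
    refine (integrable_prod_iff' hm.aestronglyMeasurable).2
      ⟨Filter.Eventually.of_forall fun x => (hFs x).const_mul (conj (F x)), ?_⟩
    simp only [Function.uncurry, norm_mul, integral_const_mul, hFn fun u => ‖F u‖]
    simp only [RCLike.norm_conj]
    exact hFi.norm.mul_const _
  rw [e1, integral_congr_ae e2, integral_const_mul, integral_integral_swap hswap]
  simp only [integral_const_mul, hFn]
  rw [integral_mul_const, integral_conj, Complex.real_smul]
  have e4 : (C : ℂ) * (conj (∫ x, F x) * (((√2)⁻¹ : ℝ) * ∫ x, F x)) =
      ((C * (√2)⁻¹ * Complex.normSq (∫ x, F x) : ℝ) : ℂ) := by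
    rw [Complex.ofReal_mul, Complex.normSq_eq_conj_mul_self]
    push_cast
    ring
  rw [e4, Complex.ofReal_re]
  exact mul_nonneg (by positivity) (Complex.normSq_nonneg _)

/-- An integrable function whose pairing with the characteristic functions of vectors is
nonnegative has a nonnegative pairing with the characteristic functions of density operators. -/
theorem IsDensityOperator.integral_kernel_mul_charFun₀_nonneg {ρ : ModeSpace →L[ℂ] ModeSpace}
    (hρ : IsDensityOperator ρ) {K : ℂ → ℂ} (hK : Integrable K)
    (h : ∀ ψ : ModeSpace, 0 ≤ (∫ ξ, K ξ * inner ℂ ψ (displacement ξ ψ)).re) :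
    0 ≤ (∫ ξ, K ξ * charFun₀ ρ ξ).re := by
  obtain ⟨φ, h1, hφ⟩ := hρ.exists_mixture
  have hI : ∀ j, Integrable fun ξ => K ξ * inner ℂ (φ j) (displacement ξ (φ j)) := fun j =>
    hK.mul_bdd (c := ‖φ j‖ * ‖φ j‖) (stronglyMeasurable_inner_displacement _ _).aestronglyMeasurable
      (Filter.Eventually.of_forall fun ξ => norm_inner_displacement_le _ _ ξ)
  have hs : Summable fun j => ∫ ξ, ‖K ξ * inner ℂ (φ j) (displacement ξ (φ j))‖ := by
    refine Summable.of_nonneg_of_le (fun _ => integral_nonneg fun _ => norm_nonneg _) (fun j => ?_)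
      (h1.summable.mul_left (∫ ξ, ‖K ξ‖))
    rw [← integral_mul_const]
    refine integral_mono (hI j).norm (hK.norm.mul_const _) fun ξ => ?_
    simp only [norm_mul, sq]
    gcongr
    exact norm_inner_displacement_le _ _ ξ
  have hsum := hasSum_integral_of_summable_integral_norm hI hs
  simp only [fun ξ => ((hφ ξ).mul_left (K ξ)).tsum_eq] at hsum
  rw [← (Complex.hasSum_re hsum).tsum_eq]
  exact tsum_nonneg fun j => h (φ j)

theorem integral_norm_sq_pow_mul_exp {m : ℝ} (hm : 0 < m) (n : ℕ) :
    ∫ ξ : ℂ, ‖ξ‖ ^ (2 * n) * Real.exp (-(m * ‖ξ‖ ^ 2) / 2) =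
      Real.pi * (2 / m) ^ (n + 1) * n.factorial := by
  have h := Complex.integral_rpow_mul_exp_neg_mul_rpow (p := 2) (q := (2 * n : ℕ)) (b := m / 2)
    one_le_two (lt_of_lt_of_le (by norm_num) (Nat.cast_nonneg _)) (by positivity)
  simp only [Real.rpow_natCast, Real.rpow_two] at h
  have e1 : (((2 * n : ℕ) : ℝ) + 2) / 2 = n + 1 := by push_cast; ring
  have e2 : -(((2 * n : ℕ) : ℝ) + 2) / 2 = -((n + 1 : ℕ) : ℝ) := by push_cast; ring
  rw [e1, e2, Real.Gamma_nat_eq_factorial, Real.rpow_neg (by positivity), Real.rpow_natCast,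
    ← inv_pow, inv_div, mul_div_cancel_left₀ _ two_ne_zero] at h
  rw [← h]
  congr 1
  funext ξ
  ring_nf

theorem integrable_norm_sq_pow_mul_exp {m : ℝ} (hm : 0 < m) (n : ℕ) :
    Integrable fun ξ : ℂ => ‖ξ‖ ^ (2 * n) * Real.exp (-(m * ‖ξ‖ ^ 2) / 2) := by
  refine Integrable.of_integral_ne_zero ?_
  rw [integral_norm_sq_pow_mul_exp hm]
  have := Real.pi_pos
  positivity

theorem gaussian_mul_displacementPhase (r x η : ℝ) :
    ((Real.exp (-‖(⟨r, η⟩ : ℂ)‖ ^ 2 / 2) : ℝ) : ℂ) * displacementPhase ⟨r, η⟩ x =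
      ((Real.exp (-r ^ 2 / 2) : ℝ) : ℂ) *
        cexp (I * ((√2 * x - r : ℝ) : ℂ) * η - ((1 / 2 : ℝ) : ℂ) * η ^ 2) := by
  rw [← Complex.normSq_eq_norm_sq, Complex.normSq_apply, displacementPhase]
  push_cast
  rw [← Complex.exp_add, ← Complex.exp_add]
  congr 1
  ring

theorem gaussian_eq_groundFun_mul (r x : ℝ) :
    Real.exp (-r ^ 2 / 2) * (√(Real.pi / (1 / 2)) *
      Real.exp (-(√2 * x - r) ^ 2 / (4 * (1 / 2)))) =
    (√(Real.pi / (1 / 2)) * √Real.pi) * (groundFun x * groundFun (x - √2 * r)) := by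
  have hp : √Real.pi * (√Real.pi)⁻¹ = 1 := mul_inv_cancel₀ (by positivity)
  have h2 : √2 ^ 2 = 2 := Real.sq_sqrt zero_le_two
  have he : Real.exp (-(x ^ 2 + (x - √2 * r) ^ 2) / 2) =
      Real.exp (-r ^ 2 / 2) * Real.exp (-(√2 * x - r) ^ 2 / (4 * (1 / 2))) := by
    rw [← Real.exp_add]
    congr 1
    linear_combination (x ^ 2 - r ^ 2) / 2 * h2
  rw [groundFun_mul_groundFun, he]
  linear_combination (-(√(Real.pi / (1 / 2)) * Real.exp (-r ^ 2 / 2) *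
    Real.exp (-(√2 * x - r) ^ 2 / (4 * (1 / 2))))) * hp

theorem IsDensityOperator.integral_ground_mul_charFun₀_nonneg {ρ : ModeSpace →L[ℂ] ModeSpace}
    (hρ : IsDensityOperator ρ) :
    0 ≤ (∫ ξ, ((Real.exp (-‖ξ‖ ^ 2 / 2) : ℝ) : ℂ) * charFun₀ ρ ξ).re := by
  have hK : Integrable fun ξ : ℂ => ((Real.exp (-‖ξ‖ ^ 2 / 2) : ℝ) : ℂ) := by
    simpa using (integrable_norm_sq_pow_mul_exp one_pos 0).ofReal (𝕜 := ℂ)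
  refine hρ.integral_kernel_mul_charFun₀_nonneg hK fun ψ => ?_
  refine integral_kernel_mul_inner_nonneg hK continuous_groundFun memLp_groundFun
    (C := √(Real.pi / (1 / 2)) * √Real.pi) (by positivity) (fun r x => ?_) ψ
  · simp only [gaussian_mul_displacementPhase]
    rw [integral_const_mul, integral_gaussian_phase one_half_pos, ← Complex.ofReal_mul,
      gaussian_eq_groundFun_mul]

theorem IsDensityOperator.integral_excited_mul_charFun₀_nonneg {ρ : ModeSpace →L[ℂ] ModeSpace}
    (hρ : IsDensityOperator ρ) :
    0 ≤ (∫ ξ, (((1 - ‖ξ‖ ^ 2) * Real.exp (-‖ξ‖ ^ 2 / 2) : ℝ) : ℂ) * charFun₀ ρ ξ).re := by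
  have hK : Integrable fun ξ : ℂ => (((1 - ‖ξ‖ ^ 2) * Real.exp (-‖ξ‖ ^ 2 / 2) : ℝ) : ℂ) := by
    have h : Integrable fun ξ : ℂ => (1 - ‖ξ‖ ^ 2) * Real.exp (-‖ξ‖ ^ 2 / 2) := by
      refine ((integrable_norm_sq_pow_mul_exp one_pos 0).sub
        (integrable_norm_sq_pow_mul_exp one_pos 1)).congr
          (Filter.Eventually.of_forall fun ξ => ?_)
      simp only [Pi.sub_apply]
      ring_nf
    exact h.ofReal
  refine hρ.integral_kernel_mul_charFun₀_nonneg hK fun ψ => ?_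
  refine integral_kernel_mul_inner_nonneg hK continuous_excitedFun memLp_excitedFun
    (C := √(Real.pi / (1 / 2)) * √Real.pi) (by positivity) (fun r x => ?_) ψ
  · have i0 := integrable_pow_mul_gaussian one_half_pos (√2 * x - r) 0
    simp only [pow_zero, one_mul] at i0
    have i2 := integrable_pow_mul_gaussian one_half_pos (√2 * x - r) 2
    have e : ∀ η : ℝ, (((1 - ‖(⟨r, η⟩ : ℂ)‖ ^ 2) * Real.exp (-‖(⟨r, η⟩ : ℂ)‖ ^ 2 / 2) : ℝ) : ℂ) *
        displacementPhase ⟨r, η⟩ x = ((Real.exp (-r ^ 2 / 2) : ℝ) : ℂ) *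
        (((1 - r ^ 2 : ℝ) : ℂ) * cexp (I * ((√2 * x - r : ℝ) : ℂ) * η - ((1 / 2 : ℝ) : ℂ) * η ^ 2) -
        η ^ 2 * cexp (I * ((√2 * x - r : ℝ) : ℂ) * η - ((1 / 2 : ℝ) : ℂ) * η ^ 2)) := by
      intro η
      rw [Complex.ofReal_mul, mul_assoc, gaussian_mul_displacementPhase,
        ← Complex.normSq_eq_norm_sq, Complex.normSq_apply]
      push_cast
      ring
    simp only [e]
    rw [integral_const_mul, integral_sub (i0.const_mul _) i2, integral_const_mul,
      integral_gaussian_phase one_half_pos, integral_sq_mul_gaussian_phase one_half_pos,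
      ← Complex.ofReal_mul, ← Complex.ofReal_sub, ← Complex.ofReal_mul]
    congr 1
    have h2 : √2 ^ 2 = 2 := Real.sq_sqrt zero_le_two
    have hx : excitedFun x * excitedFun (x - √2 * r) =
        ((√2 * x - r) ^ 2 - r ^ 2) * (groundFun x * groundFun (x - √2 * r)) := by
      simp only [excitedFun]
      linear_combination (-(√2 * x * r * groundFun x * groundFun (x - √2 * r))) * h2
    rw [hx]
    linear_combination ((√2 * x - r) ^ 2 - r ^ 2) * gaussian_eq_groundFun_mul r x

/-! ### Test functions separate quasiprobabilities -/

/-- The symplectic Fourier transform is the Fourier transform, with its argument rotated by a right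
angle and rescaled. -/
theorem symplecticFourier_eq_fourier (f : ℂ → ℂ) (ξ : ℂ) :
    symplecticFourier f ξ = (Real.pi : ℂ)⁻¹ * FourierTransform.fourier f (-(I * ξ) / Real.pi) := by
  rw [symplecticFourier, Real.fourier_eq']
  congr 1
  refine integral_congr_ae (Filter.Eventually.of_forall fun α => ?_)
  have hp : (Real.pi : ℝ) ≠ 0 := Real.pi_ne_zero
  simp only [smul_eq_mul]
  congr 2
  have e : -(I * ξ) / (Real.pi : ℂ) = ((Real.pi⁻¹ : ℝ) : ℂ) * (-(I * ξ)) := by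
    rw [Complex.ofReal_inv, div_eq_inv_mul]
  rw [e, Complex.inner]
  apply Complex.ext
  · simp
  · simp
    field_simp
    ring

/-- Every smooth function of compact support is the symplectic Fourier transform of a test
function. -/
theorem exists_testFunction {g : ℂ → ℂ} (hg : ContDiff ℝ (⊤ : ℕ∞) g) (hc : HasCompactSupport g) :
    ∃ f : TestFunction, symplecticFourier f.toSchwartz = g := by
  have hp : (Real.pi : ℂ) ≠ 0 := by exact_mod_cast Real.pi_ne_zero
  set u : ℂˣ := Units.mk0 (I * Real.pi) (mul_ne_zero Complex.I_ne_zero hp) with hu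
  set G : 𝓢(ℂ, ℂ) := (Real.pi : ℂ) • SchwartzMap.compCLMOfContinuousLinearEquiv ℂ
    (ContinuousLinearEquiv.smulLeft u) (hc.toSchwartzMap hg) with hG
  set f : 𝓢(ℂ, ℂ) := FourierTransformInv.fourierInv G with hf
  have h : symplecticFourier f = g := by
    funext ξ
    rw [symplecticFourier_eq_fourier, ← SchwartzMap.fourier_coe, hf,
      FourierTransform.fourier_fourierInv_eq, hG]
    have e : (I * Real.pi) * (-(I * ξ) / Real.pi) = ξ := by
      field_simp
      linear_combination (-ξ) * Complex.I_sq
    have e2 : ((Real.pi : ℂ) • SchwartzMap.compCLMOfContinuousLinearEquiv ℂ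
        (ContinuousLinearEquiv.smulLeft u) (hc.toSchwartzMap hg)) (-(I * ξ) / Real.pi) =
        Real.pi * g ((I * Real.pi) * (-(I * ξ) / Real.pi)) := rfl
    rw [e2, e, inv_mul_cancel_left₀ hp]
  exact ⟨⟨f, by rw [h]; exact hc⟩, h⟩

theorem dilate_quasiprobability (k : ℝˣ) (s : ℝ) (ρ : ModeSpace →L[ℂ] ModeSpace)
    (f : TestFunction) : (quasiprobability s ρ).dilate k f =
      ∫ ξ : ℂ, charFun s ρ ((k : ℝ)⁻¹ • ξ) * symplecticFourier f.toSchwartz ξ := by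
  have hk : (k : ℝ) ≠ 0 := k.ne_zero
  have h1 : ∀ ξ, symplecticFourier (f.compSmul k⁻¹).toSchwartz ξ =
      ((k : ℝ) ^ 2 : ℝ) • symplecticFourier f.toSchwartz ((k : ℝ) • ξ) := by
    intro ξ
    have h : symplecticFourier (f.compSmul k⁻¹).toSchwartz ξ = _ :=
      symplecticFourier_comp_smul k⁻¹ f.toSchwartz ξ
    simpa only [Units.val_inv_eq_inv_val, inv_inv, inv_pow] using h
  have h2 := Measure.integral_comp_smul (volume : Measure ℂ)
    (fun ξ => charFun s ρ ((k : ℝ)⁻¹ • ξ) * symplecticFourier f.toSchwartz ξ) (k : ℝ)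
  simp only [inv_smul_smul₀ hk, Complex.finrank_real_complex] at h2
  rw [abs_of_nonneg (by positivity)] at h2
  change ∫ ξ : ℂ, charFun s ρ ξ * symplecticFourier (f.compSmul k⁻¹).toSchwartz ξ = _
  simp only [h1, mul_smul_comm]
  rw [integral_smul, h2, smul_smul, mul_inv_cancel₀ (pow_ne_zero 2 hk), one_smul]

theorem IsDensityOperator.locallyIntegrable_charFun {ρ : ModeSpace →L[ℂ] ModeSpace}
    (hρ : IsDensityOperator ρ) (s k : ℝ) :
    LocallyIntegrable (fun ξ => charFun s ρ (k • ξ)) (volume : Measure ℂ) := by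
  have hc : Continuous fun ξ : ℂ => Real.exp (s * ‖k • ξ‖ ^ 2 / 2) := by fun_prop
  refine hc.locallyIntegrable.mono ?_ (Filter.Eventually.of_forall fun ξ => ?_)
  · exact ((Complex.continuous_ofReal.comp hc).stronglyMeasurable.mul
      (hρ.stronglyMeasurable_charFun₀.comp_measurable
        (measurable_const_smul k))).aestronglyMeasurable
  · rw [charFun, norm_mul, Complex.norm_real]
    exact mul_le_of_le_one_right (norm_nonneg _) (hρ.norm_charFun₀_le _)

/-- Growth of `χ_s` is harmless here: test functions with compactly supported transform only see
locally integrable functions. -/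
theorem charFun_ae_eq_of_quasiprobability_eq {σ ρ : ModeSpace →L[ℂ] ModeSpace}
    (hσ : IsDensityOperator σ) (hρ : IsDensityOperator ρ) {s : ℝ} {k : ℝˣ}
    (h : (quasiprobability s ρ).dilate k = quasiprobability s σ) :
    ∀ᵐ ξ : ℂ, charFun s σ ξ = charFun s ρ ((k : ℝ)⁻¹ • ξ) := by
  have h1 : LocallyIntegrable (charFun s σ) (volume : Measure ℂ) := by
    simpa using hσ.locallyIntegrable_charFun s 1
  refine ae_eq_of_integral_contDiff_smul_eq h1 (hρ.locallyIntegrable_charFun s _) fun g hg hc => ?_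
  obtain ⟨f, hf⟩ := exists_testFunction (g := fun ξ => (g ξ : ℂ))
    (Complex.ofRealCLM.contDiff.comp hg) (hc.comp_left (g := Complex.ofReal) Complex.ofReal_zero)
  have h2 := (dilate_quasiprobability k s ρ f).symm.trans (congrFun h f)
  simp only [quasiprobability, hf] at h2
  simp only [Complex.real_smul, mul_comm _ (charFun s _ _)]
  simpa only [Complex.real_smul] using h2.symm

/-! ### Which scaling maps are positive -/

theorem charFun_eq_iff (s k : ℝ) (σ ρ : ModeSpace →L[ℂ] ModeSpace) (ξ : ℂ) :
    charFun s σ ξ = charFun s ρ (k • ξ) ↔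
      charFun₀ σ ξ = ((Real.exp (-(s * (1 - k ^ 2) * ‖ξ‖ ^ 2) / 2) : ℝ) : ℂ) *
        charFun₀ ρ (k * ξ) := by
  have h0 : ((Real.exp (s * ‖ξ‖ ^ 2 / 2) : ℝ) : ℂ) ≠ 0 := by
    exact_mod_cast (Real.exp_pos _).ne'
  have h1 : Real.exp (s * ‖k • ξ‖ ^ 2 / 2) =
      Real.exp (s * ‖ξ‖ ^ 2 / 2) * Real.exp (-(s * (1 - k ^ 2) * ‖ξ‖ ^ 2) / 2) := by
    rw [← Real.exp_add, norm_smul, mul_pow, Real.norm_eq_abs, sq_abs]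
    ring_nf
  rw [charFun, charFun, h1, Complex.ofReal_mul, mul_assoc, Complex.real_smul]
  exact mul_right_inj' h0

theorem integral_one_sub_mul_gaussian {m : ℝ} (hm : 0 < m) (d : ℝ) :
    ∫ ξ : ℂ, (1 - d * ‖ξ‖ ^ 2) * Real.exp (-(m * ‖ξ‖ ^ 2) / 2) =
      2 * Real.pi / m ^ 2 * (m - 2 * d) := by
  have i0 := integrable_norm_sq_pow_mul_exp hm 0
  have i1 := integrable_norm_sq_pow_mul_exp hm 1
  have v0 := integral_norm_sq_pow_mul_exp hm 0
  have v1 := integral_norm_sq_pow_mul_exp hm 1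
  have e : ∀ ξ : ℂ, (1 - d * ‖ξ‖ ^ 2) * Real.exp (-(m * ‖ξ‖ ^ 2) / 2) =
      ‖ξ‖ ^ (2 * 0) * Real.exp (-(m * ‖ξ‖ ^ 2) / 2) -
        d * (‖ξ‖ ^ (2 * 1) * Real.exp (-(m * ‖ξ‖ ^ 2) / 2)) := fun ξ => by
    rw [mul_zero, mul_one, pow_zero]; ring
  simp only [e]
  rw [integral_sub i0 (i1.const_mul d), integral_const_mul, v0, v1]
  have hm0 := hm.ne'
  norm_num [Nat.factorial]
  field_simp

/-- For `|s| ≤ 1`, the scaling `χ_s(ξ) ↦ χ_s(t ξ)`, `t = k⁻¹`, is positive exactly when the Gaussian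
factor `exp (-s (1 - t²) |ξ|² / 2)` that it puts on `χ₀` is that of an attenuator or amplifier. -/
theorem mapsTo_dilate_iff {s : ℝ} (hs : -1 ≤ s ∧ s ≤ 1) (k : ℝˣ) :
    Set.MapsTo (GenFunction.dilate k) (quasiprobabilities s) (quasiprobabilities s) ↔
      s * (1 - ((k : ℝ)⁻¹) ^ 2) = |1 - ((k : ℝ)⁻¹) ^ 2| := by
  set t : ℝ := (k : ℝ)⁻¹ with ht
  have ht0 : t ≠ 0 := inv_ne_zero k.ne_zero
  have ht2 : 0 < t ^ 2 := by positivity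
  constructor
  · intro hmap
    by_contra hne
    -- the image of every density operator `ρ`, in terms of symmetrically ordered functions
    have himg : ∀ ρ, IsDensityOperator ρ → ∃ σ, IsDensityOperator σ ∧ ∀ᵐ ξ : ℂ, charFun₀ σ ξ =
        ((Real.exp (-(s * (1 - t ^ 2) * ‖ξ‖ ^ 2) / 2) : ℝ) : ℂ) * charFun₀ ρ (t * ξ) := by
      intro ρ hρ
      obtain ⟨σ, hσ, h⟩ := hmap ⟨ρ, hρ, rfl⟩
      refine ⟨σ, hσ, ?_⟩
      filter_upwards [charFun_ae_eq_of_quasiprobability_eq hσ hρ h] with ξ hξ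
      exact (charFun_eq_iff s t σ ρ ξ).1 hξ
    have hnorm : ∀ ξ : ℂ, ‖(t : ℂ) * ξ‖ ^ 2 = t ^ 2 * ‖ξ‖ ^ 2 := fun ξ => by
      rw [norm_mul, mul_pow, Complex.norm_real, Real.norm_eq_abs, sq_abs]
    rcases le_total (1 - t ^ 2) 0 with h1 | h1
    · -- amplification: the image of the first excited state has negative overlap with the ground
      -- state
      rw [abs_of_nonpos h1] at hne
      have h1' : 1 - t ^ 2 < 0 := lt_of_le_of_ne h1 fun h => hne (by rw [h]; simp)
      have hs1 : -1 < s := lt_of_le_of_ne hs.1 fun h => hne (by rw [← h]; ring)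
      obtain ⟨ρ, hρ, hχ⟩ := exists_isDensityOperator_excited
      obtain ⟨σ, hσ, hσχ⟩ := himg ρ hρ
      have hpos := hσ.integral_ground_mul_charFun₀_nonneg
      set m : ℝ := 1 + s * (1 - t ^ 2) + t ^ 2 with hmdef
      have hm : 0 < m := by nlinarith
      have e : ∫ ξ, ((Real.exp (-‖ξ‖ ^ 2 / 2) : ℝ) : ℂ) * charFun₀ σ ξ =
          ((∫ ξ : ℂ, (1 - t ^ 2 * ‖ξ‖ ^ 2) * Real.exp (-(m * ‖ξ‖ ^ 2) / 2) : ℝ) : ℂ) := by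
        rw [← integral_complex_ofReal]
        refine integral_congr_ae ?_
        filter_upwards [hσχ] with ξ hξ
        rw [hξ, hχ, hnorm, ← Complex.ofReal_mul, ← Complex.ofReal_mul]
        congr 1
        rw [mul_left_comm _ (1 - _), mul_left_comm _ (1 - _), ← Real.exp_add, ← Real.exp_add]
        congr 2
        rw [hmdef]
        ring
      rw [e, Complex.ofReal_re, integral_one_sub_mul_gaussian hm] at hpos
      have hneg : m - 2 * t ^ 2 < 0 := by nlinarith
      have : 0 < 2 * Real.pi / m ^ 2 := by have := Real.pi_pos; positivity
      nlinarith
    · -- attenuation: the image of the ground state has negative overlap with the first excited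
      -- state
      rw [abs_of_nonneg h1] at hne
      have h1' : 0 < 1 - t ^ 2 := lt_of_le_of_ne h1 fun h => hne (by rw [← h]; simp)
      have hs1 : s < 1 := lt_of_le_of_ne hs.2 fun h => hne (by rw [h]; ring)
      obtain ⟨ρ, hρ, hχ⟩ := exists_isDensityOperator_ground
      obtain ⟨σ, hσ, hσχ⟩ := himg ρ hρ
      have hpos := hσ.integral_excited_mul_charFun₀_nonneg
      set m : ℝ := 1 + s * (1 - t ^ 2) + t ^ 2 with hmdef
      have hm : 0 < m := by nlinarith
      have e : ∫ ξ, (((1 - ‖ξ‖ ^ 2) * Real.exp (-‖ξ‖ ^ 2 / 2) : ℝ) : ℂ) * charFun₀ σ ξ =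
          ((∫ ξ : ℂ, (1 - 1 * ‖ξ‖ ^ 2) * Real.exp (-(m * ‖ξ‖ ^ 2) / 2) : ℝ) : ℂ) := by
        rw [← integral_complex_ofReal]
        refine integral_congr_ae ?_
        filter_upwards [hσχ] with ξ hξ
        rw [hξ, hχ, hnorm, ← Complex.ofReal_mul, ← Complex.ofReal_mul]
        congr 1
        rw [one_mul, mul_assoc, ← Real.exp_add, ← Real.exp_add]
        congr 2
        rw [hmdef]
        ring
      rw [e, Complex.ofReal_re, integral_one_sub_mul_gaussian hm] at hpos
      have hneg : m - 2 * 1 < 0 := by nlinarith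
      have : 0 < 2 * Real.pi / m ^ 2 := by have := Real.pi_pos; positivity
      nlinarith
  · rintro hst _ ⟨ρ, hρ, rfl⟩
    obtain ⟨σ, hσ, h⟩ := hρ.exists_scaled ht0
    refine ⟨σ, hσ, funext fun f => ?_⟩
    rw [dilate_quasiprobability]
    refine integral_congr_ae (Filter.Eventually.of_forall fun ξ => ?_)
    have : charFun s σ ξ = charFun s ρ (t • ξ) := by
      rw [charFun_eq_iff, h, hst, abs_sub_comm]
    simp only [this, ht]

end QuasiProb

end

theorem proposition1 (s : ℝ) (hs : -1 ≤ s ∧ s ≤ 1) (a : ℝˣ) :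
    QuasiProb.ScalingMapPositive s a⁻¹ ↔ QuasiProb.DualScalingMapPositive s a⁻¹ := by
  have ha : 0 < (a : ℝ) ^ 2 := by have := a.ne_zero; positivity
  have h1 : QuasiProb.ScalingMapPositive s a⁻¹ ↔ s * (1 - ((a : ℝ)⁻¹) ^ 2) =
      |1 - ((a : ℝ)⁻¹) ^ 2| := by
    have h : QuasiProb.scaling a⁻¹ = QuasiProb.GenFunction.dilate a := by
      funext Λ
      rw [QuasiProb.scaling, inv_inv]
    rw [QuasiProb.ScalingMapPositive, h]
    exact QuasiProb.mapsTo_dilate_iff hs a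
  have h2 : QuasiProb.DualScalingMapPositive s a⁻¹ ↔ -s * (1 - (a : ℝ) ^ 2) =
      |1 - (a : ℝ) ^ 2| := by
    have h := QuasiProb.mapsTo_dilate_iff (s := -s) ⟨by linarith [hs.2], by linarith [hs.1]⟩ a⁻¹
    rwa [Units.val_inv_eq_inv_val, inv_inv] at h
  -- the two conditions differ by the positive factor `a²`
  have e : 1 - ((a : ℝ)⁻¹) ^ 2 = ((a : ℝ) ^ 2)⁻¹ * -(1 - (a : ℝ) ^ 2) := by
    field_simp
    ring
  rw [h1, h2, e, abs_mul, abs_neg, abs_of_pos (inv_pos.2 ha), mul_left_comm,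
    mul_right_inj' (inv_pos.2 ha).ne', mul_neg, neg_mul]
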